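/- Conventions. For $n\ge 0$ let $T^n=\{(\lambda_0,\dots,\lambda_n)\in\mathbb R^{n+1}:\lambda_i\ge 0,\ \sum_i\lambda_i=1\}$ be the standard simplex. For $r\in\mathbb Z$ let $\mathcal P_r\Lambda^k(\mathbb R^{n+1})$ be the space of differential $k$-forms on $\mathbb R^{n+1}$ whose coefficients are real polynomials of degree at most $r$ (the zero space if $r<0$), and let $\mathcal P_r^-\Lambda^k(\mathbb R^{n+1})$ be the image of $\mathcal P_{r-1}\Lambda^{k+1}(\mathbb R^{n+1})$ under the contraction $i_X$ with the position vector field $X(\lambda)=\lambda$, where $(i_X\alpha)(Y_1,\dots,Y_k)=\alpha(X,Y_1,\dots,Y_k)$. Let $\mathcal P_r\Lambda^k(T^n)$ and $\mathcal P_r^-\Lambda^k(T^n)$ be the images of these spaces under restriction (pullback) of forms to $T^n$, and let $\mathring{\mathcal P}_r\Lambda^k(T^n)$ and $\mathring{\mathcal P}_r^-\Lambda^k(T^n)$ be the subspaces of those forms whose trace (pullback) on each $(n-1)$-dimensional face of $T^n$ vanishes. The symmetric group $S_{n+1}$ of permutations of $\{0,\dots,n\}$ acts linearly on all four spaces by $\pi\cdot\alpha=S_\pi^*\alpha$,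 where $S_\pi(\lambda_0,\dots,\lambda_n)=(\lambda_{\pi(0)},\dots,\lambda_{\pi(n)})$. A basis $\xi_1,\dots,\xi_m$ of a finite-dimensional real representation $V$ of a group $G$ is called $G$-invariant up to sign if for every $g\in G$ and every $i$ there is a $j$ with $g\xi_i=\xi_j$ or $g\xi_i=-\xi_j$ (the zero space has the empty basis, which is invariant). Theorem 4.1. Let $r\in\mathbb Z$ and $\mathbb N_0=\{0,1,2,\dots\}$. Then: 1. $\mathcal P_r\Lambda^1(T^2)$ has an $S_3$-invariant basis up to sign if and only if $r\notin 3\mathbb N_0$; 2. $\mathcal P_r^-\Lambda^1(T^2)$ has an $S_3$-invariant basis up to sign if and only if $r\notin 3\mathbb N_0+2$; 3. $\mathring{\mathcal P}_r\Lambda^1(T^2)$ has an $S_3$-invariant basis up to sign if and only if $r\notin 3\mathbb N_0+3$; 4. $\mathring{\mathcal P}_r^-\Lambda^1(T^2)$ has an $S_3$-invariant basis up to sign if and only if $r\notin 3\mathbb N_0+2$. -/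

import Mathlib

namespace FEEC

/-! ### Bases that are invariant up to sign -/

/-- A (finite-dimensional, real) representation `ρ` of `G` on `V` has a `G`-invariant basis up to
sign: there is a basis `ξ₁, …, ξₘ` of `V` such that for all `g` and `i` one has
`g ξᵢ = ± ξⱼ` for some `j`. -/
def HasInvariantBasisUpToSign {G V : Type*} [Group G] [AddCommGroup V] [Module ℝ V]
    (ρ : Representation ℝ G V) : Prop :=
  ∃ (m : ℕ) (ξ : Module.Basis (Fin m) ℝ V),
    ∀ (g : G) (i : Fin m), ∃ j : Fin m, ρ g (ξ i) = ξ j ∨ ρ g (ξ i) = -ξ j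

/-- The previous notion for a subrepresentation `W` of `ρ`, with the restricted action. -/
def SubHasInvariantBasisUpToSign {G V : Type*} [Group G] [AddCommGroup V] [Module ℝ V]
    {ρ : Representation ℝ G V} (W : Subrepresentation ρ) : Prop :=
  HasInvariantBasisUpToSign (V := W.toSubmodule) W.toRepresentation

/-! ### Differential forms on `ℝⁿ⁺¹` and on the standard simplex `Tⁿ` -/

/-- `k`-forms on `ℝⁿ⁺¹`: each point is given an alternating `k`-linear form on `ℝⁿ⁺¹`. No
regularity is built in; all the spaces below consist of forms with polynomial coefficients. -/
abbrev AmbientForm (k n : ℕ) : Type :=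
  (Fin (n + 1) → ℝ) → (Fin (n + 1) → ℝ) [⋀^Fin k]→ₗ[ℝ] ℝ

/-- The standard simplex `Tⁿ ⊂ ℝⁿ⁺¹`: nonnegative tuples `(λ₀, …, λₙ)` with sum `1`. -/
abbrev Simplex (n : ℕ) : Type := stdSimplex ℝ (Fin (n + 1))

/-- The tangent space of `Tⁿ` (the same at each of its points): vectors with coordinate sum `0`. -/
def tangent (n : ℕ) : Submodule ℝ (Fin (n + 1) → ℝ) where
  carrier := {v | ∑ i, v i = 0}
  zero_mem' := by simp
  add_mem' {v w} hv hw := by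
    simp only [Set.mem_ofPred_eq] at hv hw ⊢
    simp [Finset.sum_add_distrib, hv, hw]
  smul_mem' c v hv := by
    simp only [Set.mem_ofPred_eq] at hv ⊢
    simp [← Finset.mul_sum, hv]

/-- `k`-forms on the simplex `Tⁿ` (no regularity is built in). -/
abbrev SimplexForm (k n : ℕ) : Type := Simplex n → tangent n [⋀^Fin k]→ₗ[ℝ] ℝ

/-- Restriction of `k`-forms from `ℝⁿ⁺¹` to `Tⁿ`, the pullback along the inclusion. -/
def restrict (k n : ℕ) : AmbientForm k n →ₗ[ℝ] SimplexForm k n where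
  toFun ω x := (ω x.1).compLinearMap (tangent n).subtype
  map_add' _ _ := rfl
  map_smul' _ _ := rfl

/-! ### The polynomial spaces on `ℝⁿ⁺¹` -/

/-- `𝒫_r Λᵏ(ℝⁿ⁺¹)`: forms such that each coefficient `ω(e_{I(1)}, …, e_{I(k)})` is a polynomial all
of whose monomials have degree at most `r`. For `r < 0` this is the zero space. -/
def ambientP (r : ℤ) (k n : ℕ) : Submodule ℝ (AmbientForm k n) where
  carrier := {ω | ∀ I : Fin k → Fin (n + 1), ∃ p : MvPolynomial (Fin (n + 1)) ℝ,
    (∀ d ∈ p.support, (d.degree : ℤ) ≤ r) ∧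
      ∀ x, ω x (fun a => Pi.single (I a) 1) = MvPolynomial.eval x p}
  zero_mem' I := ⟨0, by simp, by simp⟩
  add_mem' {ω η} hω hη I := by
    obtain ⟨p, hp, hp'⟩ := hω I
    obtain ⟨q, hq, hq'⟩ := hη I
    refine ⟨p + q, fun d hd => ?_, fun x => by simp [hp', hq']⟩
    rcases Finset.mem_union.1 (MvPolynomial.support_add hd) with h | h
    exacts [hp d h, hq d h]
  smul_mem' c ω hω I := by
    obtain ⟨p, hp, hp'⟩ := hω I
    exact ⟨c • p, fun d hd => hp d (MvPolynomial.support_smul hd), fun x => by simp [hp']⟩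

/-- Contraction `i_X` of a `(k+1)`-form on `ℝⁿ⁺¹` with the position vector field `X`:
`(i_X α)(Y₁, …, Y_k) = α(X, Y₁, …, Y_k)`, where `X` has the value `x` at the point `x`. -/
def contractX (k n : ℕ) : AmbientForm (k + 1) n →ₗ[ℝ] AmbientForm k n where
  toFun α x := (α x).curryLeft x
  map_add' _ _ := rfl
  map_smul' _ _ := rfl

/-- `𝒫_r⁻ Λᵏ(ℝⁿ⁺¹) = i_X (𝒫_{r-1} Λᵏ⁺¹(ℝⁿ⁺¹))`. -/
def ambientPMinus (r : ℤ) (k n : ℕ) : Submodule ℝ (AmbientForm k n) :=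
  (ambientP (r - 1) (k + 1) n).map (contractX k n)

/-! ### The action of the symmetric group -/

/-- The permutation of coordinates `(λ₀, …, λₙ) ↦ (λ_{π(0)}, …, λ_{π(n)})` on `ℝⁿ⁺¹`. -/
abbrev permCoords {n : ℕ} (π : Equiv.Perm (Fin (n + 1))) :
    (Fin (n + 1) → ℝ) →ₗ[ℝ] (Fin (n + 1) → ℝ) :=
  LinearMap.funLeft ℝ ℝ π

/-- The map `S_π : Tⁿ → Tⁿ`, `S_π(λ₀, …, λₙ) = (λ_{π(0)}, …, λ_{π(n)})`. -/
def permSimplex {n : ℕ} (π : Equiv.Perm (Fin (n + 1))) (x : Simplex n) : Simplex n :=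
  ⟨permCoords π x.1, fun i => x.2.1 (π i), by
    simpa [LinearMap.funLeft_apply] using (Equiv.sum_comp π x.1).trans x.2.2⟩

/-- The differential of `S_π` on tangent vectors of `Tⁿ`. -/
def permTangent {n : ℕ} (π : Equiv.Perm (Fin (n + 1))) : tangent n →ₗ[ℝ] tangent n :=
  (permCoords π).restrict fun v hv => by
    change ∑ i, v (π i) = 0
    exact (Equiv.sum_comp π v).trans hv

/-- The representation of `S_{n+1}` on the `k`-forms on `Tⁿ` in which `π` acts by the pullback
`S_π^*`, that is, `(S_π^* α)_x(v₁, …, v_k) = α_{S_π x}(S_π v₁, …, S_π v_k)`. -/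
def pullbackRep (k n : ℕ) : Representation ℝ (Equiv.Perm (Fin (n + 1))) (SimplexForm k n) where
  toFun π :=
    { toFun := fun α x => (α (permSimplex π x)).compLinearMap (permTangent π)
      map_add' := fun _ _ => rfl
      map_smul' := fun _ _ => rfl }
  map_one' := rfl
  map_mul' _ _ := rfl

/-! ### Traces on the facets -/

/-- The facet of `Tⁿ` opposite to the `i`-th vertex, an `(n-1)`-dimensional face. -/
abbrev Facet (n : ℕ) (i : Fin (n + 1)) : Type := {x : Simplex n // x.1 i = 0}

/-- The tangent space of the facet opposite to the `i`-th vertex, inside that of `Tⁿ`. -/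
def facetTangent (n : ℕ) (i : Fin (n + 1)) : Submodule ℝ (tangent n) :=
  LinearMap.ker ((LinearMap.proj i : (Fin (n + 1) → ℝ) →ₗ[ℝ] ℝ) ∘ₗ (tangent n).subtype)

/-- The trace of `k`-forms on `Tⁿ` on the facet opposite to the `i`-th vertex: the pullback along
the inclusion of that facet. -/
def facetTrace (k n : ℕ) (i : Fin (n + 1)) :
    SimplexForm k n →ₗ[ℝ] (Facet n i → facetTangent n i [⋀^Fin k]→ₗ[ℝ] ℝ) where
  toFun α x := (α x.1).compLinearMap (facetTangent n i).subtype
  map_add' _ _ := rfl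
  map_smul' _ _ := rfl

/-! ### The finite element spaces on `Tⁿ`, as representations of `S_{n+1}` -/

/-- Pullback of forms on `ℝⁿ⁺¹` along a permutation of the coordinates. -/
def ambientPullback (k n : ℕ) (π : Equiv.Perm (Fin (n + 1))) :
    AmbientForm k n →ₗ[ℝ] AmbientForm k n where
  toFun ω x := (ω (permCoords π x)).compLinearMap (permCoords π)
  map_add' _ _ := rfl
  map_smul' _ _ := rfl

theorem ambientPullback_mem_ambientP {r : ℤ} {k n : ℕ} (π : Equiv.Perm (Fin (n + 1)))
    {ω : AmbientForm k n} (hω : ω ∈ ambientP r k n) :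
    ambientPullback k n π ω ∈ ambientP r k n := by
  intro I
  obtain ⟨p, hp, hp'⟩ := hω (fun a => π.symm (I a))
  refine ⟨MvPolynomial.rename π p, fun d hd => ?_, fun x => ?_⟩
  · classical
    rw [MvPolynomial.support_rename_of_injective π.injective, Finset.mem_image] at hd
    obtain ⟨e, he, rfl⟩ := hd
    rw [Finsupp.degree_mapDomain]
    exact hp e he
  · rw [MvPolynomial.eval_rename]
    refine Eq.trans ?_ (hp' _)
    change ω _ _ = ω _ _
    congr 1
    funext a j
    simp [LinearMap.funLeft_apply, Pi.single_apply, Equiv.eq_symm_apply]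

theorem ambientPullback_mem_ambientPMinus {r : ℤ} {k n : ℕ} (π : Equiv.Perm (Fin (n + 1)))
    {ω : AmbientForm k n} (hω : ω ∈ ambientPMinus r k n) :
    ambientPullback k n π ω ∈ ambientPMinus r k n := by
  obtain ⟨α, hα, rfl⟩ := hω
  refine ⟨ambientPullback (k + 1) n π α, ambientPullback_mem_ambientP π hα, ?_⟩
  funext x
  ext v
  change α _ _ = α _ _
  congr 1
  funext a
  refine Fin.cases rfl (fun _ => rfl) a

/-- `𝒫_r Λᵏ(Tⁿ)`: the image of `𝒫_r Λᵏ(ℝⁿ⁺¹)` under restriction to `Tⁿ`. -/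
def P (r : ℤ) (k n : ℕ) : Subrepresentation (pullbackRep k n) where
  toSubmodule := (ambientP r k n).map (restrict k n)
  apply_mem_toSubmodule π α hα := by
    obtain ⟨ω, hω, rfl⟩ := hα
    exact ⟨ambientPullback k n π ω, ambientPullback_mem_ambientP π hω, rfl⟩

/-- `𝒫_r⁻ Λᵏ(Tⁿ)`: the image of `𝒫_r⁻ Λᵏ(ℝⁿ⁺¹)` under restriction to `Tⁿ`. -/
def PMinus (r : ℤ) (k n : ℕ) : Subrepresentation (pullbackRep k n) where
  toSubmodule := (ambientPMinus r k n).map (restrict k n)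
  apply_mem_toSubmodule π α hα := by
    obtain ⟨ω, hω, rfl⟩ := hα
    exact ⟨ambientPullback k n π ω, ambientPullback_mem_ambientPMinus π hω, rfl⟩

/-- The forms on `Tⁿ` with vanishing trace on `∂Tⁿ`, that is, on each `(n-1)`-dimensional face. -/
def traceFree (k n : ℕ) : Subrepresentation (pullbackRep k n) where
  toSubmodule := ⨅ i, LinearMap.ker (facetTrace k n i)
  apply_mem_toSubmodule π α hα := by
    simp only [Submodule.mem_iInf, LinearMap.mem_ker] at hα ⊢
    intro i
    funext x
    ext v
    have hx : (permSimplex π x.1).1 (π.symm i) = 0 := by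
      change x.1.1 (π (π.symm i)) = 0
      rw [Equiv.apply_symm_apply]
      exact x.2
    have hv : ∀ a, permTangent π (v a).1 ∈ facetTangent n (π.symm i) := fun a => by
      change (v a).1.1 (π (π.symm i)) = 0
      rw [Equiv.apply_symm_apply]
      exact (v a).2
    exact DFunLike.congr_fun (congrFun (hα (π.symm i)) ⟨permSimplex π x.1, hx⟩)
      (fun a => ⟨permTangent π (v a).1, hv a⟩)

/-- `𝒫̊_r Λᵏ(Tⁿ)`: the forms in `𝒫_r Λᵏ(Tⁿ)` with vanishing trace on `∂Tⁿ`. -/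
def PTraceFree (r : ℤ) (k n : ℕ) : Subrepresentation (pullbackRep k n) :=
  P r k n ⊓ traceFree k n

/-- `𝒫̊_r⁻ Λᵏ(Tⁿ)`: the forms in `𝒫_r⁻ Λᵏ(Tⁿ)` with vanishing trace on `∂Tⁿ`. -/
def PMinusTraceFree (r : ℤ) (k n : ℕ) : Subrepresentation (pullbackRep k n) :=
  PMinus r k n ⊓ traceFree k n

end FEEC

/-! A representation of `S₃` has a signed invariant basis exactly when a 3-cycle has nonnegative
trace (`hasInvariantBasisUpToSign_iff`). In a signed basis the 3-cycle has no diagonal entry `-1`,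
because its cube is the identity. Conversely, let the one-dimensional representations (trivial or
sign) occur `p` times in all and the standard one `c` times; the trace is `p - c`. If `c ≤ p`, pair
each standard copy with a one-dimensional one. Each pair is a three-dimensional representation with
a signed basis consisting of a single orbit of the 3-cycle, and the unpaired lines are signed
already (`exists_signed_basis`).

The traces come from equivariant exact sequences. Write `H_s` for homogeneous polynomials of degree
`s` in three variables, zero for `s < 0`. Since `∑ λᵢ = 1` on the triangle, polynomials of degree at
most `s` may be replaced by elements of `H_s`. With respect to the 3-cycle, the sequences are `0 →
H_r → H_r³ → 𝒫_r → 0`, `0 → H_{r-2} → H_{r-1}³ → 𝒫_r⁻ → 0`, `0 → H_{r-2} → H_{r-2}³ → 𝒫̊_r⁻ → 0`, `0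
→ 𝒫̊_r → H_{r-1}³ → H_r → 0` for `r ≠ 0`. The 3-cycle permutes the three factors of a triple without
fixing any, so it has trace zero there, and every trace sought is minus the trace on some `H_s`. The
latter counts the monomials fixed by rotation, `(λ₀λ₁λ₂)^m`, so it is positive exactly when `s ∈
3ℕ₀` (`trace_rot_nonpos_iff`). The space `𝒫̊_0` is zero and is treated separately. -/

namespace FEEC

open MvPolynomial

/-! ### Traces -/

section Trace

variable {K V U : Type*} [AddCommGroup K] [Module ℝ K] [AddCommGroup V] [Module ℝ V]
  [AddCommGroup U] [Module ℝ U]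

/-- The trace is additive on short exact sequences of vector spaces with endomorphisms. -/
theorem trace_add_trace_of_exact [Module.Finite ℝ V] [Module.Finite ℝ K] [Module.Finite ℝ U]
    {i : K →ₗ[ℝ] V} {f : V →ₗ[ℝ] U} {a : K →ₗ[ℝ] K} {b : V →ₗ[ℝ] V} {c : U →ₗ[ℝ] U}
    (hi : Function.Injective i) (hf : Function.Surjective f)
    (hfi : ∀ x, f x = 0 ↔ ∃ y, i y = x)
    (hab : ∀ y, b (i y) = i (a y)) (hbc : ∀ x, f (b x) = c (f x)) :
    LinearMap.trace ℝ V b = LinearMap.trace ℝ K a + LinearMap.trace ℝ U c := by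
  obtain ⟨s, hs⟩ := f.exists_rightInverse_of_surjective (LinearMap.range_eq_top.2 hf)
  obtain ⟨p₀, hp₀⟩ := i.exists_leftInverse_of_injective (LinearMap.ker_eq_bot.2 hi)
  have hs' : ∀ u, f (s u) = u := fun u => LinearMap.congr_fun hs u
  have hp₀' : ∀ y, p₀ (i y) = y := fun y => LinearMap.congr_fun hp₀ y
  -- The correction makes the retraction vanish on the image of `s`, so that `i ∘ p + s ∘ f = 1`;
  -- cyclicity of the trace then isolates the two diagonal blocks of `b`.
  let p : V →ₗ[ℝ] K := p₀ - p₀ ∘ₗ s ∘ₗ f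
  have hid : ∀ x, i (p x) + s (f x) = x := fun x => by
    obtain ⟨y, hy⟩ := (hfi (x - s (f x))).1 (by simp [hs'])
    have : p x = y := by
      change p₀ x - p₀ (s (f x)) = y
      rw [← map_sub, ← hy, hp₀']
    rw [this, hy, sub_add_cancel]
  have hpi : ∀ y, p (i y) = y := fun y => by
    change p₀ (i y) - p₀ (s (f (i y))) = y
    rw [(hfi _).2 ⟨y, rfl⟩, map_zero, map_zero, hp₀', sub_zero]
  have h1 : b = (b ∘ₗ i) ∘ₗ p + (b ∘ₗ s) ∘ₗ f := by
    ext x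
    change b x = b (i (p x)) + b (s (f x))
    rw [← map_add, hid]
  rw [h1, map_add, LinearMap.trace_comp_comm' p, LinearMap.trace_comp_comm' f]
  congr 2
  · ext y
    simp [hab, hpi]
  · ext y
    simp [hbc, hs']

/-- An endomorphism of a power that moves each factor to a different one has trace zero. -/
theorem trace_pi_eq_zero {n : ℕ} [Module.Finite ℝ V] (b : (Fin n → V) →ₗ[ℝ] (Fin n → V))
    (hb : ∀ i x, b (Pi.single i x) i = 0) : LinearMap.trace ℝ (Fin n → V) b = 0 := by
  have h1 : b = ∑ i, (b ∘ₗ LinearMap.single ℝ (fun _ => V) i) ∘ₗ LinearMap.proj i := by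
    refine LinearMap.ext fun x => ?_
    simp only [LinearMap.sum_apply, LinearMap.comp_apply, LinearMap.proj_apply, LinearMap.coe_single]
    rw [← map_sum, Finset.univ_sum_single]
  rw [h1, map_sum]
  refine Finset.sum_eq_zero fun i _ => ?_
  rw [LinearMap.trace_comp_comm']
  convert map_zero (LinearMap.trace ℝ V)
  ext x
  exact hb i x

/-- In a basis which `b` permutes up to sign, without sending a basis vector to its negative, the
diagonal entries of `b` are nonnegative. -/
theorem trace_nonneg_of_signed {m : ℕ} (ξ : Module.Basis (Fin m) ℝ V) (b : V →ₗ[ℝ] V)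
    (h : ∀ i, ∃ j, b (ξ i) = ξ j ∨ b (ξ i) = -ξ j) (hb : ∀ v, b (b (b v)) = v) :
    0 ≤ LinearMap.trace ℝ V b := by
  rw [LinearMap.trace_eq_matrix_trace ℝ ξ]
  refine Finset.sum_nonneg fun i _ => ?_
  rw [Matrix.diag_apply, LinearMap.toMatrix_apply]
  obtain ⟨j, hj | hj⟩ := h i
  · rw [hj, ξ.repr_self, Finsupp.single_apply]
    split_ifs <;> norm_num
  -- A diagonal entry `-1` would give `b³ = -1` on that basis vector, against `b³ = 1`.
  · have hij : j ≠ i := by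
      rintro rfl
      have h1 := hb (ξ j)
      rw [hj, map_neg, hj, neg_neg, hj] at h1
      refine ξ.ne_zero j ((smul_eq_zero.1 (?_ : (2 : ℝ) • ξ j = 0)).resolve_left two_ne_zero)
      linear_combination (norm := module) (-1 : ℝ) • h1
    simp [hj, hij]

end Trace

/-! ### Signed bases for representations of `S₃` -/

section Signed

variable {V : Type*} [AddCommGroup V] [Module ℝ V]

/-- The vectors fixed by `s` on which `t` acts as multiplication by `ε`. -/
def fixedEigen (s t : V →ₗ[ℝ] V) (ε : ℝ) : Submodule ℝ V :=
  LinearMap.ker (s - 1) ⊓ LinearMap.ker (t - ε • 1)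

theorem mem_fixedEigen {s t : V →ₗ[ℝ] V} {ε : ℝ} {v : V} :
    v ∈ fixedEigen s t ε ↔ s v = v ∧ t v = ε • v := by
  simp [fixedEigen, sub_eq_zero]

/-- The vectors fixed by `t` whose `s`-orbit sums to zero. -/
def standardFixed (s t : V →ₗ[ℝ] V) : Submodule ℝ V :=
  LinearMap.ker (1 + s + s ∘ₗ s) ⊓ LinearMap.ker (t - 1)

theorem mem_standardFixed {s t : V →ₗ[ℝ] V} {v : V} :
    v ∈ standardFixed s t ↔ v + s v + s (s v) = 0 ∧ t v = v := by
  simp [standardFixed, sub_eq_zero]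

/-- The isotypic decomposition of a representation of `S₃ = ⟨s, t⟩`. -/
def isotypicMap (s t : V →ₗ[ℝ] V) :
    ((fixedEigen s t 1 × fixedEigen s t (-1)) × (standardFixed s t × standardFixed s t)) →ₗ[ℝ] V :=
  ((fixedEigen s t 1).subtype.coprod (fixedEigen s t (-1)).subtype).coprod
    ((standardFixed s t).subtype.coprod (s ∘ₗ (standardFixed s t).subtype))

theorem isotypicMap_apply (s t : V →ₗ[ℝ] V) (u : fixedEigen s t 1) (u' : fixedEigen s t (-1))
    (b c : standardFixed s t) :
    isotypicMap s t ((u, u'), (b, c)) = (u + u' : V) + (b + s c) := rfl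

variable {s t : V →ₗ[ℝ] V}

/-- The operator `1 + s + s²` kills the standard part and isolates `u + u'`, whose terms `t`
separates. Applying `t` to `b + s c = 0` then gives `s c = s² c`, so `c` is fixed by `s` while its
orbit sums to zero. -/
theorem isotypicMap_injective (hs : ∀ v, s (s (s v)) = v) (hts : ∀ v, t (s v) = s (s (t v))) :
    Function.Injective (isotypicMap s t) := by
  rw [injective_iff_map_eq_zero]
  rintro ⟨⟨⟨u, hu⟩, ⟨u', hu'⟩⟩, ⟨⟨b, hb⟩, ⟨c, hc⟩⟩⟩ h
  rw [isotypicMap_apply] at h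
  simp only at h
  obtain ⟨hu1, hu2⟩ := mem_fixedEigen.1 hu
  obtain ⟨hu1', hu2'⟩ := mem_fixedEigen.1 hu'
  obtain ⟨hb1, hb2⟩ := mem_standardFixed.1 hb
  obtain ⟨hc1, hc2⟩ := mem_standardFixed.1 hc
  have e1 := congrArg s h
  have e2 := congrArg s e1
  simp only [map_add, map_zero, hu1, hu1', hs] at e1 e2
  have huu : u + u' = 0 := by
    have : (3 : ℝ) • (u + u') = 0 := by
      linear_combination (norm := module) h + e1 + e2 - hb1 - hc1
    exact (smul_eq_zero.1 this).resolve_left (by norm_num)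
  have huu2 : u - u' = 0 := by
    have := congrArg t huu
    rw [map_add, hu2, hu2', map_zero] at this
    linear_combination (norm := module) this
  have hu0 : u = 0 := by
    have : (2 : ℝ) • u = 0 := by linear_combination (norm := module) huu + huu2
    exact (smul_eq_zero.1 this).resolve_left (by norm_num)
  have hu0' : u' = 0 := by rw [hu0, zero_add] at huu; exact huu
  have hbc : b + s c = 0 := by rw [huu, zero_add] at h; exact h
  have e3 := congrArg t hbc
  rw [map_add, map_zero, hts, hc2, hb2] at e3
  have e4 : s c = s (s c) := by linear_combination (norm := module) hbc - e3
  have e5 : s c = c := by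
    have := congrArg s e4
    rw [hs] at this
    rw [e4, this]
  have hc0 : c = 0 := by
    have : (3 : ℝ) • c = 0 := by
      rw [e5, e5] at hc1
      linear_combination (norm := module) hc1
    exact (smul_eq_zero.1 this).resolve_left (by norm_num)
  have hb0 : b = 0 := by rw [hc0, map_zero, add_zero] at hbc; exact hbc
  subst hu0 hu0' hc0 hb0
  rfl

theorem isotypicMap_surjective (hs : ∀ v, s (s (s v)) = v) (ht : ∀ v, t (t v) = v)
    (hts : ∀ v, t (s v) = s (s (t v))) : Function.Surjective (isotypicMap s t) := by
  intro v
  -- The first two components are group averages. For the remainder `w`, the equation `w = b + s c`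
  -- forces `w - t w = (s - s²) c`, and `(s - s²)² = -3` on vectors with zero orbit sum; this gives
  -- `c`, then `b`.
  refine ⟨((⟨(1 / 6 : ℝ) • (v + s v + s (s v) + t v + s (t v) + s (s (t v))), ?_⟩,
    ⟨(1 / 6 : ℝ) • (v + s v + s (s v) - t v - s (t v) - s (s (t v))), ?_⟩),
    (⟨(1 / 3 : ℝ) • (v - s v + t v - s (s (t v))), ?_⟩,
      ⟨(1 / 3 : ℝ) • (s (s v) - s v + s (t v) - s (s (t v))), ?_⟩)), ?_⟩
  · rw [mem_fixedEigen]
    simp only [map_add, map_smul, hs, ht, hts]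
    constructor <;> module
  · rw [mem_fixedEigen]
    simp only [map_add, map_smul, map_sub, hs, ht, hts]
    constructor <;> module
  · rw [mem_standardFixed]
    simp only [map_add, map_smul, map_sub, hs, ht, hts]
    constructor <;> module
  · rw [mem_standardFixed]
    simp only [map_add, map_smul, map_sub, hs, ht, hts]
    constructor <;> module
  · rw [isotypicMap_apply]
    simp only [map_add, map_smul, map_sub, hs]
    module


/-- The vector `y` generates the same standard copy as `w` but has the `t`-eigenvalue of `u`. If `u`
is of sign type, `s w - s² w` works, since `t` swaps its two terms. When `u` is also fixed by `s`,
the `s`-orbit of `u + y` is permuted up to sign by the whole group. -/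
theorem exists_partner (hs : ∀ v, s (s (s v)) = v) (hts : ∀ v, t (s v) = s (s (t v)))
    {u w : V} (hu : t u = u ∨ t u = -u) (hw : w ∈ standardFixed s t) :
    ∃ y : V, y + s y + s (s y) = 0 ∧ (∃ α β : ℝ, w = α • y + β • s y) ∧
      (t (u + y) = u + y ∨ t (u + y) = -(u + y)) := by
  obtain ⟨h1, h2⟩ := mem_standardFixed.1 hw
  rcases hu with hu | hu
  · exact ⟨w, h1, ⟨1, 0, by module⟩, Or.inl (by rw [map_add, hu, h2])⟩
  · refine ⟨s w - s (s w), ?_, ⟨-1 / 3, -2 / 3, ?_⟩, Or.inr ?_⟩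
    · simp only [map_sub, hs]
      module
    · simp only [map_sub, hs]
      linear_combination (norm := module) (1 / 3 : ℝ) • h1
    · simp only [map_add, map_sub, hs, hts, h2, hu]
      module

section Finite

variable [Module.Finite ℝ V]

theorem finrank_eq_isotypic (hs : ∀ v, s (s (s v)) = v) (ht : ∀ v, t (t v) = v)
    (hts : ∀ v, t (s v) = s (s (t v))) :
    Module.finrank ℝ V = Module.finrank ℝ (fixedEigen s t 1) +
      Module.finrank ℝ (fixedEigen s t (-1)) + 2 * Module.finrank ℝ (standardFixed s t) := by
  have h := (LinearEquiv.ofBijective (isotypicMap s t)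
    ⟨isotypicMap_injective hs hts, isotypicMap_surjective hs ht hts⟩).finrank_eq
  rw [Module.finrank_prod, Module.finrank_prod, Module.finrank_prod] at h
  omega

/-- The averaging operator is a projection onto the eigenspace, so its trace is the dimension. -/
theorem trace_fixedEigen_proj (hs : ∀ v, s (s (s v)) = v) (ht : ∀ v, t (t v) = v)
    (hts : ∀ v, t (s v) = s (s (t v))) {ε : ℝ} (hε : ε * ε = 1) :
    LinearMap.trace ℝ V ((1 / 6 : ℝ) • ((1 + s + s ∘ₗ s) ∘ₗ (1 + ε • t))) =
      Module.finrank ℝ (fixedEigen s t ε) := by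
  refine LinearMap.IsProj.trace ⟨fun v => ?_, fun v hv => ?_⟩
  · rw [mem_fixedEigen]
    simp only [LinearMap.smul_apply, LinearMap.comp_apply, LinearMap.add_apply,
      Module.End.one_apply, map_add, map_smul, hs, ht, hts]
    constructor
    · module
    · linear_combination (norm := module) (-(1 / 6 : ℝ) * hε) • (t v + s (t v) + s (s (t v)))
  · obtain ⟨h1, h2⟩ := mem_fixedEigen.1 hv
    simp only [LinearMap.smul_apply, LinearMap.comp_apply, LinearMap.add_apply,
      Module.End.one_apply, map_add, map_smul, h1, h2]
    linear_combination (norm := module) ((1 / 2 : ℝ) * hε) • v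

/-- The two averaging projections add up to `(1 + s + s²)/3`, and `s² = t s t` has the same trace as
`s`. Hence `(dim V + 2 tr s)/3` is the number of one-dimensional summands; the dimension count
eliminates `dim V`. -/
theorem trace_eq_isotypic (hs : ∀ v, s (s (s v)) = v) (ht : ∀ v, t (t v) = v)
    (hts : ∀ v, t (s v) = s (s (t v))) :
    LinearMap.trace ℝ V s = Module.finrank ℝ (fixedEigen s t 1) +
      Module.finrank ℝ (fixedEigen s t (-1)) - Module.finrank ℝ (standardFixed s t) := by
  have h1 := trace_fixedEigen_proj hs ht hts (ε := 1) (by norm_num)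
  have h2 := trace_fixedEigen_proj hs ht hts (ε := -1) (by norm_num)
  have h3 : LinearMap.trace ℝ V (s ∘ₗ s) = LinearMap.trace ℝ V s := by
    have e1 : s ∘ₗ s = t ∘ₗ (s ∘ₗ t) := by
      ext v
      simp [hts, ht]
    have e2 : (s ∘ₗ t) ∘ₗ t = s := by
      ext v
      simp [ht]
    rw [e1, LinearMap.trace_comp_comm', e2]
  have h4 : (1 / 6 : ℝ) • ((1 + s + s ∘ₗ s) ∘ₗ (1 + (1 : ℝ) • t)) +
      (1 / 6 : ℝ) • ((1 + s + s ∘ₗ s) ∘ₗ (1 + (-1 : ℝ) • t)) =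
      (1 / 3 : ℝ) • (1 + s + s ∘ₗ s) := by
    ext v
    simp only [LinearMap.smul_apply, LinearMap.comp_apply, LinearMap.add_apply,
      Module.End.one_apply, map_add, map_smul]
    module
  have h5 := congrArg (LinearMap.trace ℝ V) h4
  rw [map_add, h1, h2, map_smul, map_add, map_add, h3, LinearMap.trace_one,
    finrank_eq_isotypic hs ht hts] at h5
  push_cast at h5
  rw [smul_eq_mul] at h5
  linarith

/-- The vectors fixed by `s` have a spanning family of eigenvectors of `t`. -/
theorem exists_fixed_family (s t : V →ₗ[ℝ] V) :
    ∃ u : Fin (Module.finrank ℝ (fixedEigen s t 1) + Module.finrank ℝ (fixedEigen s t (-1))) → V,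
      (∀ i, s (u i) = u i ∧ (t (u i) = u i ∨ t (u i) = -u i)) ∧
      ∀ ε : ℝ, ε = 1 ∨ ε = -1 → fixedEigen s t ε ≤ Submodule.span ℝ (Set.range u) := by
  let b₁ := Module.finBasis ℝ (fixedEigen s t 1)
  let b₂ := Module.finBasis ℝ (fixedEigen s t (-1))
  refine ⟨Fin.append (fun i => (b₁ i : V)) (fun i => (b₂ i : V)), fun i => ?_, ?_⟩
  · refine Fin.addCases (fun i => ?_) (fun i => ?_) i
    · obtain ⟨h1, h2⟩ := mem_fixedEigen.1 (b₁ i).2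
      rw [Fin.append_left]
      exact ⟨h1, Or.inl (by rw [h2, one_smul])⟩
    · obtain ⟨h1, h2⟩ := mem_fixedEigen.1 (b₂ i).2
      rw [Fin.append_right]
      exact ⟨h1, Or.inr (by rw [h2, neg_smul, one_smul])⟩
  · rintro ε (rfl | rfl) v hv
    · have h := congrArg Subtype.val (b₁.sum_repr ⟨v, hv⟩)
      rw [← show _ = v from h, Submodule.coe_sum]
      refine Submodule.sum_mem _ fun i _ => ?_
      rw [Submodule.coe_smul]
      exact Submodule.smul_mem _ _ (Submodule.subset_span ⟨Fin.castAdd _ i, Fin.append_left ..⟩)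
    · have h := congrArg Subtype.val (b₂.sum_repr ⟨v, hv⟩)
      rw [← show _ = v from h, Submodule.coe_sum]
      refine Submodule.sum_mem _ fun i _ => ?_
      rw [Submodule.coe_smul]
      exact Submodule.smul_mem _ _ (Submodule.subset_span ⟨Fin.natAdd _ i, Fin.append_right ..⟩)

/-- Nonnegative trace supplies at least as many one-dimensional vectors `u` as standard copies. The
basis consists of the orbits of `z j = u j + y j`, with `y j` from `exists_partner`, together with
the unpaired `u`. -/
theorem exists_signed_basis (hs : ∀ v, s (s (s v)) = v) (ht : ∀ v, t (t v) = v)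
    (hts : ∀ v, t (s v) = s (s (t v))) (htr : 0 ≤ LinearMap.trace ℝ V s) :
    ∃ (m : ℕ) (ξ : Module.Basis (Fin m) ℝ V),
      (∀ i, ∃ j, s (ξ i) = ξ j ∨ s (ξ i) = -ξ j) ∧
      (∀ i, ∃ j, t (ξ i) = ξ j ∨ t (ξ i) = -ξ j) := by
  have hdim := finrank_eq_isotypic hs ht hts
  rw [trace_eq_isotypic hs ht hts] at htr
  obtain ⟨p, hp, u, hu, hspan⟩ : ∃ p, p = Module.finrank ℝ (fixedEigen s t 1) +
      Module.finrank ℝ (fixedEigen s t (-1)) ∧ ∃ u : Fin p → V,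
      (∀ i, s (u i) = u i ∧ (t (u i) = u i ∨ t (u i) = -u i)) ∧
      ∀ ε : ℝ, ε = 1 ∨ ε = -1 → fixedEigen s t ε ≤ Submodule.span ℝ (Set.range u) :=
    ⟨_, rfl, exists_fixed_family s t⟩
  rw [← hp] at hdim
  have hcp : Module.finrank ℝ (standardFixed s t) ≤ p := by
    rw [hp]
    exact_mod_cast sub_nonneg.1 htr
  obtain ⟨c, hc, ⟨w⟩⟩ : ∃ c, c = Module.finrank ℝ (standardFixed s t) ∧
      Nonempty (Module.Basis (Fin c) ℝ (standardFixed s t)) :=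
    ⟨_, rfl, ⟨Module.finBasis ℝ (standardFixed s t)⟩⟩
  rw [← hc] at hdim hcp
  obtain ⟨d, rfl⟩ := Nat.exists_eq_add_of_le hcp
  choose y hy0 hyw hyt using fun j : Fin c =>
    exists_partner hs hts (hu (Fin.castAdd d j)).2 (w j).2
  let z : Fin c → V := fun j => u (Fin.castAdd d j) + y j
  let b : (Fin c ⊕ Fin c ⊕ Fin c) ⊕ Fin d → V :=
    Sum.elim (Sum.elim z (Sum.elim (fun j => s (z j)) (fun j => s (s (z j)))))
      (fun k => u (Fin.natAdd c k))
  have hb : ∀ i, b i ∈ Submodule.span ℝ (Set.range b) := fun i =>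
    Submodule.subset_span ⟨i, rfl⟩
  have hz0 : ∀ j, z j ∈ Submodule.span ℝ (Set.range b) := fun j => hb (.inl (.inl j))
  have hz1 : ∀ j, s (z j) ∈ Submodule.span ℝ (Set.range b) := fun j => hb (.inl (.inr (.inl j)))
  have hz2 : ∀ j, s (s (z j)) ∈ Submodule.span ℝ (Set.range b) := fun j =>
    hb (.inl (.inr (.inr j)))
  have hub : ∀ i, u i ∈ Submodule.span ℝ (Set.range b) := fun i => by
    refine Fin.addCases (fun j => ?_) (fun k => hb (.inr k)) i
    -- The orbit of `y j` sums to zero, so the orbit of `z j` sums to `3 u j`; this recovers `u j`,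
    -- and then `y j` and its translates.
    have : u (Fin.castAdd d j) = (1 / 3 : ℝ) • (z j + s (z j) + s (s (z j))) := by
      simp only [z, map_add, (hu _).1]
      linear_combination (norm := module) (-(1 / 3) : ℝ) • hy0 j
    rw [this]
    exact Submodule.smul_mem _ _ (add_mem (add_mem (hz0 j) (hz1 j)) (hz2 j))
  have hy : ∀ j, y j ∈ Submodule.span ℝ (Set.range b) := fun j => by
    have : y j = z j - u (Fin.castAdd d j) := by simp [z]
    rw [this]
    exact sub_mem (hz0 j) (hub _)
  have hsy : ∀ j, s (y j) ∈ Submodule.span ℝ (Set.range b) := fun j => by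
    have : s (y j) = s (z j) - u (Fin.castAdd d j) := by simp [z, (hu _).1]
    rw [this]
    exact sub_mem (hz1 j) (hub _)
  have hssy : ∀ j, s (s (y j)) ∈ Submodule.span ℝ (Set.range b) := fun j => by
    have : s (s (y j)) = s (s (z j)) - u (Fin.castAdd d j) := by simp [z, (hu _).1]
    rw [this]
    exact sub_mem (hz2 j) (hub _)
  have hfix : ∀ ε : ℝ, ε = 1 ∨ ε = -1 →
      fixedEigen s t ε ≤ Submodule.span ℝ (Set.range b) := fun ε hε =>
    (hspan ε hε).trans (Submodule.span_le.2 (Set.range_subset_iff.2 hub))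
  have hstd : ∀ v ∈ standardFixed s t, v ∈ Submodule.span ℝ (Set.range b) ∧
      s v ∈ Submodule.span ℝ (Set.range b) := fun v hv => by
    have h : ∑ j, w.repr ⟨v, hv⟩ j • (w j : V) = v := by
      simpa only [Submodule.coe_sum, Submodule.coe_smul] using
        congrArg Subtype.val (w.sum_repr ⟨v, hv⟩)
    rw [← h, map_sum]
    refine ⟨Submodule.sum_mem _ fun j _ => Submodule.smul_mem _ _ ?_,
      Submodule.sum_mem _ fun j _ => ?_⟩
    · obtain ⟨α, β, hw⟩ := hyw j
      rw [hw]
      exact add_mem (Submodule.smul_mem _ _ (hy j)) (Submodule.smul_mem _ _ (hsy j))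
    · obtain ⟨α, β, hw⟩ := hyw j
      rw [map_smul, hw, map_add, map_smul, map_smul]
      exact Submodule.smul_mem _ _
        (add_mem (Submodule.smul_mem _ _ (hsy j)) (Submodule.smul_mem _ _ (hssy j)))
  have htop : ⊤ ≤ Submodule.span ℝ (Set.range b) := fun v _ => by
    obtain ⟨⟨⟨x, x'⟩, ⟨r, q⟩⟩, rfl⟩ := isotypicMap_surjective hs ht hts v
    rw [isotypicMap_apply]
    exact add_mem (add_mem (hfix 1 (.inl rfl) x.2) (hfix (-1) (.inr rfl) x'.2))
      (add_mem (hstd _ r.2).1 (hstd _ q.2).2)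
  -- With `p = c + d`, the family has `3c + d = p + 2c = dim V` members, so spanning suffices.
  have hcard : Fintype.card ((Fin c ⊕ Fin c ⊕ Fin c) ⊕ Fin d) = Module.finrank ℝ V := by
    simp only [Fintype.card_sum, Fintype.card_fin]
    omega
  let ξ := basisOfTopLeSpanOfCardEqFinrank b htop hcard
  have hξ : ∀ i, ξ i = b i := fun i => by simp [ξ]
  have hbs : ∀ i, ∃ j, s (b i) = b j ∨ s (b i) = -b j := by
    rintro ((j | j | j) | k)
    · exact ⟨.inl (.inr (.inl j)), .inl rfl⟩
    · exact ⟨.inl (.inr (.inr j)), .inl rfl⟩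
    · exact ⟨.inl (.inl j), .inl (hs _)⟩
    · exact ⟨.inr k, .inl (hu _).1⟩
  have hbt : ∀ i, ∃ j, t (b i) = b j ∨ t (b i) = -b j := by
    rintro ((j | j | j) | k)
    · exact ⟨.inl (.inl j), hyt j⟩
    · refine ⟨.inl (.inr (.inr j)), ?_⟩
      change t (s (z j)) = s (s (z j)) ∨ t (s (z j)) = -s (s (z j))
      rw [hts]
      exact (hyt j).imp (fun h => by rw [h]) (fun h => by rw [h, map_neg, map_neg])
    · refine ⟨.inl (.inr (.inl j)), ?_⟩
      change t (s (s (z j))) = s (z j) ∨ t (s (s (z j))) = -s (z j)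
      rw [hts, hts, hs]
      exact (hyt j).imp (fun h => by rw [h]) (fun h => by rw [h, map_neg])
    · exact ⟨.inr k, (hu _).2⟩
  let e := Fintype.equivFin ((Fin c ⊕ Fin c ⊕ Fin c) ⊕ Fin d)
  refine ⟨_, ξ.reindex e, fun i => ?_, fun i => ?_⟩
  · obtain ⟨j, hj⟩ := hbs (e.symm i)
    exact ⟨e j, by simpa [hξ] using hj⟩
  · obtain ⟨j, hj⟩ := hbt (e.symm i)
    exact ⟨e j, by simpa [hξ] using hj⟩

end Finite

end Signed

/-- A representation of `S₃` has an invariant basis up to sign if and only if the 3-cycles have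
nonnegative trace. -/
theorem hasInvariantBasisUpToSign_iff {V : Type*} [AddCommGroup V] [Module ℝ V] [Module.Finite ℝ V]
    (ρ : Representation ℝ (Equiv.Perm (Fin 3)) V) :
    HasInvariantBasisUpToSign ρ ↔ 0 ≤ LinearMap.trace ℝ V (ρ (finRotate 3)) := by
  have hs : ∀ v, ρ (finRotate 3) (ρ (finRotate 3) (ρ (finRotate 3) v)) = v := fun v => by
    rw [← Module.End.mul_apply, ← Module.End.mul_apply, ← map_mul, ← map_mul,
      show finRotate 3 * finRotate 3 * finRotate 3 = 1 by decide, map_one, Module.End.one_apply]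
  constructor
  · rintro ⟨m, ξ, h⟩
    exact trace_nonneg_of_signed ξ _ (h _) hs
  · intro htr
    obtain ⟨m, ξ, h1, h2⟩ := exists_signed_basis (t := ρ (Equiv.swap 0 1)) hs
      (fun v => by
        rw [← Module.End.mul_apply, ← map_mul, Equiv.swap_mul_self, map_one, Module.End.one_apply])
      (fun v => by
        simp only [← Module.End.mul_apply, ← map_mul]
        rw [show Equiv.swap 0 1 * finRotate 3 =
          finRotate 3 * (finRotate 3 * Equiv.swap 0 1) by decide])
      htr
    refine ⟨m, ξ, fun g => ?_⟩
    -- Acting by signed permutations is stable under products, so the two generators suffice.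
    have hmul : ∀ a b : Equiv.Perm (Fin 3),
        (∀ i, ∃ j, ρ a (ξ i) = ξ j ∨ ρ a (ξ i) = -ξ j) →
        (∀ i, ∃ j, ρ b (ξ i) = ξ j ∨ ρ b (ξ i) = -ξ j) →
        ∀ i, ∃ j, ρ (a * b) (ξ i) = ξ j ∨ ρ (a * b) (ξ i) = -ξ j := by
      intro a b ha hb i
      obtain ⟨j, hj⟩ := hb i
      obtain ⟨k, hk⟩ := ha j
      refine ⟨k, ?_⟩
      rw [map_mul, Module.End.mul_apply]
      rcases hj with hj | hj <;> rcases hk with hk | hk <;> simp [hj, hk]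
    have hone : ∀ i, ∃ j, ρ 1 (ξ i) = ξ j ∨ ρ 1 (ξ i) = -ξ j := fun i => ⟨i, by simp⟩
    have hg : ∀ g : Equiv.Perm (Fin 3), g = 1 ∨ g = finRotate 3 ∨
        g = finRotate 3 * finRotate 3 ∨ g = Equiv.swap 0 1 ∨ g = finRotate 3 * Equiv.swap 0 1 ∨
        g = finRotate 3 * (finRotate 3 * Equiv.swap 0 1) := by decide
    rcases hg g with rfl | rfl | rfl | rfl | rfl | rfl
    exacts [hone, h1, hmul _ _ h1 h1, h2, hmul _ _ h1 h2, hmul _ _ h1 (hmul _ _ h1 h2)]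

/-! ### Homogeneous polynomials in three variables -/

/-- Homogeneous polynomials of degree `s` in three variables; the zero space if `s < 0`. -/
noncomputable def homog (s : ℤ) : Submodule ℝ (MvPolynomial (Fin 3) ℝ) :=
  restrictSupport ℝ {d | (d.degree : ℤ) = s}

variable {s : ℤ} {p q : MvPolynomial (Fin 3) ℝ}

theorem mem_homog : p ∈ homog s ↔ ∀ d, coeff d p ≠ 0 → (d.degree : ℤ) = s := by
  simp only [homog, mem_restrictSupport_iff, Set.subset_def, Finset.mem_coe, mem_support_iff,
    Set.mem_ofPred_eq]

theorem X_mul_mem_homog_iff {i : Fin 3} : X i * p ∈ homog s ↔ p ∈ homog (s - 1) := by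
  classical
  rw [mem_homog, mem_homog]
  constructor
  · intro h d hd
    have := h (Finsupp.single i 1 + d) (by rwa [coeff_X_mul])
    rw [map_add, Finsupp.degree_single] at this
    push_cast at this
    omega
  · intro h d hd
    rw [coeff_X_mul'] at hd
    split_ifs at hd with hi
    · have h1 := h _ hd
      have h2 : d - Finsupp.single i 1 + Finsupp.single i 1 = d :=
        tsub_add_cancel_of_le (by
          rw [Finsupp.single_le_iff]
          exact Nat.one_le_iff_ne_zero.2 (Finsupp.mem_support_iff.1 hi))
      have h3 := congrArg Finsupp.degree h2
      rw [map_add, Finsupp.degree_single] at h3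
      omega
    · exact absurd rfl hd

theorem X_mul_mem_homog {i : Fin 3} (h : p ∈ homog s) : X i * p ∈ homog (s + 1) := by
  rw [X_mul_mem_homog_iff]
  simpa using h

theorem rename_mem_homog (π : Equiv.Perm (Fin 3)) (h : p ∈ homog s) : rename π p ∈ homog s := by
  classical
  rw [mem_homog] at h ⊢
  intro d hd
  obtain ⟨u, hu, hu'⟩ := coeff_rename_ne_zero π p d hd
  rw [← hu, Finsupp.degree_mapDomain]
  exact h u hu'

instance (s : ℤ) : Finite {d : Fin 3 →₀ ℕ | (d.degree : ℤ) = s} :=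
  ((Finsupp.finite_of_degree_le s.toNat).subset fun d (hd : (d.degree : ℤ) = s) => by
    change d.degree ≤ s.toNat
    omega).to_subtype

instance (s : ℤ) : Module.Finite ℝ (homog s) :=
  Module.Finite.of_basis (basisRestrictSupport ℝ {d : Fin 3 →₀ ℕ | (d.degree : ℤ) = s})

theorem eval_smul_of_mem_homog (h : p ∈ homog s) (t : ℝ) (x : Fin 3 → ℝ) :
    eval (t • x) p = t ^ s.toNat * eval x p := by
  rw [eval_eq', eval_eq', Finset.mul_sum]
  refine Finset.sum_congr rfl fun d hd => ?_
  have hd' := mem_homog.1 h d (mem_support_iff.1 hd)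
  -- A monomial is present, so `s ≥ 0` and `toNat` loses nothing; for `s < 0` the sum is empty.
  have h1 : d.degree = s.toNat := by omega
  rw [← h1, Finsupp.degree_eq_sum]
  simp only [Pi.smul_apply, smul_eq_mul, mul_pow, Finset.prod_mul_distrib, Finset.prod_pow_eq_pow_sum]
  ring

/-- Rescaling to coordinate sum one preserves the zero coordinates, so the same statement serves
both the full simplex and its facets. -/
theorem eval_eq_zero_of_simplex (h : p ∈ homog s) {y : Fin 3 → ℝ} (hy : ∀ i, 0 ≤ y i)
    (hpos : 0 < ∑ i, y i)
    (h0 : ∀ x : Simplex 2, (∀ i, y i = 0 → x.1 i = 0) → eval x.1 p = 0) : eval y p = 0 := by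
  have h1 : y = (∑ i, y i) • ((∑ i, y i)⁻¹ • y) := by
    rw [smul_smul, mul_inv_cancel₀ hpos.ne', one_smul]
  rw [h1, eval_smul_of_mem_homog h]
  refine mul_eq_zero_of_right _ (h0 ⟨(∑ i, y i)⁻¹ • y, fun i => ?_, ?_⟩ fun i hi => ?_)
  · exact mul_nonneg (inv_nonneg.2 hpos.le) (hy i)
  · simp only [Pi.smul_apply, smul_eq_mul]
    rw [← Finset.mul_sum, inv_mul_cancel₀ hpos.ne']
  · simp [hi]

theorem eq_zero_of_eval_pos (h : ∀ y : Fin 3 → ℝ, (∀ i, 0 < y i) → eval y p = 0) : p = 0 :=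
  funext_set (fun _ => Set.Ioi 0) (fun _ => Set.Ioi_infinite 0) fun y hy => by
    rw [map_zero]
    exact h y fun i => hy i trivial

theorem eq_zero_of_simplex (h : p ∈ homog s) (h0 : ∀ x : Simplex 2, eval x.1 p = 0) : p = 0 :=
  eq_zero_of_eval_pos fun _ hy => eval_eq_zero_of_simplex h (fun i => (hy i).le)
    (Finset.sum_pos (fun i _ => hy i) Finset.univ_nonempty) fun x _ => h0 x

/-- The remainder of `p` modulo `X k` does not involve `X k` and agrees with `p` where that
coordinate is zero. By homogeneity it therefore vanishes at all positive points, so it is zero. -/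
theorem exists_eq_X_mul_of_facet (h : p ∈ homog s) {k : Fin 3}
    (h0 : ∀ x : Simplex 2, x.1 k = 0 → eval x.1 p = 0) : ∃ q ∈ homog (s - 1), p = X k * q := by
  classical
  have hdvd : X k ∣ p := by
    rw [X_dvd_iff_modMonomial_eq_zero]
    have hmod := p.divMonomial_add_modMonomial_single k
    set m := p.modMonomial (Finsupp.single k 1) with hm
    have hmk : ∀ d ∈ m.support, d k = 0 := by
      intro d hd
      by_contra hk
      refine mem_support_iff.1 hd (coeff_modMonomial_of_le _ ?_)
      rw [Finsupp.single_le_iff]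
      exact Nat.one_le_iff_ne_zero.2 hk
    refine eq_zero_of_eval_pos fun y hy => ?_
    let y' := Function.update y k 0
    have h1 : eval y m = eval y' m := by
      rw [eval_eq', eval_eq']
      refine Finset.sum_congr rfl fun d hd => ?_
      congr 1
      refine Finset.prod_congr rfl fun i _ => ?_
      by_cases hik : i = k
      · rw [hik, hmk d hd, pow_zero, pow_zero]
      · simp [y', hik]
    have h2 : eval y' m = eval y' p := by
      rw [← hmod]
      simp [y']
    rw [h1, h2]
    refine eval_eq_zero_of_simplex h (fun i => ?_) ?_ fun x hx => h0 x (hx k (by simp [y']))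
    · by_cases hik : i = k
      · simp [y', hik]
      · simpa [y', hik] using (hy i).le
    · obtain ⟨j, hj⟩ := exists_ne k
      refine Finset.sum_pos' (fun i _ => ?_) ⟨j, Finset.mem_univ _, ?_⟩
      · by_cases hik : i = k
        · simp [y', hik]
        · simpa [y', hik] using (hy i).le
      · simpa [y', hj] using hy j
  obtain ⟨q, rfl⟩ := hdvd
  exact ⟨q, X_mul_mem_homog_iff.1 h, rfl⟩

theorem sum_X_pow_mul_mem_homog (n : ℕ) (h : p ∈ homog s) :
    (∑ i, X i) ^ n * p ∈ homog (s + n) := by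
  induction n with
  | zero => simpa using h
  | succ n ih =>
    rw [pow_succ', mul_assoc, Finset.sum_mul, Nat.cast_succ, ← add_assoc]
    exact Submodule.sum_mem _ fun i _ => X_mul_mem_homog ih

/-- Each monomial is multiplied by a power of `∑ X i`, which equals one on the simplex. -/
theorem exists_homogenization {r : ℤ} (h : ∀ d ∈ p.support, (d.degree : ℤ) ≤ r) :
    ∃ q ∈ homog r, ∀ x : Simplex 2, eval x.1 q = eval x.1 p := by
  refine ⟨∑ d ∈ p.support, (∑ i, X i) ^ (r - d.degree).toNat * monomial d (coeff d p),
    Submodule.sum_mem _ fun d hd => ?_, fun x => ?_⟩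
  · have h1 : monomial d (coeff d p) ∈ homog (d.degree : ℤ) :=
      (monomial_mem_restrictSupport ℝ).2 (Or.inl rfl)
    have h2 := sum_X_pow_mul_mem_homog (r - d.degree).toNat h1
    rwa [Int.toNat_of_nonneg (by have := h d hd; omega), add_sub_cancel] at h2
  · conv_rhs => rw [← support_sum_monomial_coeff p]
    have hx : ∑ i, x.1 i = 1 := x.2.2
    rw [map_sum, map_sum]
    refine Finset.sum_congr rfl fun d _ => ?_
    rw [map_mul, map_pow, map_sum]
    simp only [eval_X, hx, one_pow, one_mul]

/-! ### The action of the 3-cycle -/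

/-- The action of the 3-cycle on homogeneous polynomials. -/
noncomputable def rot (s : ℤ) : homog s →ₗ[ℝ] homog s :=
  (rename (finRotate 3)).toLinearMap.restrict fun _ h => rename_mem_homog _ h

theorem coe_rot (p : homog s) : (rot s p : MvPolynomial (Fin 3) ℝ) = rename (finRotate 3) p.1 := rfl

/-- The action of the 3-cycle on triples of homogeneous polynomials. -/
noncomputable def rotTriple (s : ℤ) : (Fin 3 → homog s) →ₗ[ℝ] (Fin 3 → homog s) :=
  LinearMap.pi fun j => rot s ∘ₗ LinearMap.proj ((finRotate 3).symm j)

theorem rotTriple_apply (f : Fin 3 → homog s) (j : Fin 3) :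
    rotTriple s f j = rot s (f ((finRotate 3).symm j)) := rfl

theorem trace_rotTriple (s : ℤ) : LinearMap.trace ℝ _ (rotTriple s) = 0 :=
  trace_pi_eq_zero _ fun i x => by
    rw [rotTriple_apply, Pi.single_eq_of_ne (by revert i; decide), map_zero]

theorem mapDomain_finRotate_eq_iff (d : Fin 3 →₀ ℕ) :
    Finsupp.mapDomain (finRotate 3) d = d ↔ d 0 = d 1 ∧ d 1 = d 2 := by
  have h : ∀ j, Finsupp.mapDomain (finRotate 3) d (finRotate 3 j) = d j := fun j =>
    Finsupp.mapDomain_apply (finRotate 3).injective d j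
  have h0 : Finsupp.mapDomain (finRotate 3) d 1 = d 0 := h 0
  have h1 : Finsupp.mapDomain (finRotate 3) d 2 = d 1 := h 1
  have h2 : Finsupp.mapDomain (finRotate 3) d 0 = d 2 := h 2
  constructor
  · intro e
    rw [e] at h0 h1
    exact ⟨h0.symm, h1.symm⟩
  · rintro ⟨e1, e2⟩
    ext i
    fin_cases i
    · exact h2.trans (e2.symm.trans e1.symm)
    · exact h0.trans e1
    · exact h1.trans e2

/-- The rotation permutes the monomials, so the trace counts the fixed ones, those with all
exponents equal. One exists in degree `s` exactly when `s` is three times a natural number. -/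
theorem trace_rot_nonpos_iff (s : ℤ) :
    LinearMap.trace ℝ _ (rot s) ≤ 0 ↔ ¬ ∃ m : ℕ, s = 3 * (m : ℤ) := by
  classical
  have := Fintype.ofFinite {d : Fin 3 →₀ ℕ | (d.degree : ℤ) = s}
  let b : Module.Basis {d : Fin 3 →₀ ℕ | (d.degree : ℤ) = s} ℝ (homog s) :=
    basisRestrictSupport ℝ {d : Fin 3 →₀ ℕ | (d.degree : ℤ) = s}
  have hb' : ∀ (p : homog s) d, b.repr p d = coeff d.1 p.1 := fun p d => by
    rfl
  have hb : ∀ d, (b d : MvPolynomial (Fin 3) ℝ) = monomial d.1 1 := fun d => by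
    rw [(Module.Basis.apply_eq_iff
      (x := ⟨monomial d.1 1, (monomial_mem_restrictSupport ℝ).2 (Or.inl d.2)⟩)).2]
    ext e
    rw [hb', coeff_monomial, Finsupp.single_apply]
    simp only [Subtype.ext_iff]
  have hdiag : ∀ d, LinearMap.toMatrix b b (rot s) d d =
      if d.1 0 = d.1 1 ∧ d.1 1 = d.1 2 then 1 else 0 := fun d => by
    rw [LinearMap.toMatrix_apply, hb', coe_rot, hb, rename_monomial, coeff_monomial]
    simp only [mapDomain_finRotate_eq_iff]
  rw [LinearMap.trace_eq_matrix_trace ℝ b]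
  simp only [Matrix.trace, Matrix.diag_apply, hdiag]
  have hnn : ∀ d ∈ (Finset.univ : Finset {d : Fin 3 →₀ ℕ | (d.degree : ℤ) = s}),
      (0 : ℝ) ≤ if d.1 0 = d.1 1 ∧ d.1 1 = d.1 2 then 1 else 0 := fun d _ => by
    split_ifs <;> norm_num
  rw [(Finset.sum_nonneg hnn).ge_iff_eq', Finset.sum_eq_zero_iff_of_nonneg hnn]
  constructor
  · rintro h ⟨m, hm⟩
    have hdeg : (((Finsupp.equivFunOnFinite.symm fun _ => m : Fin 3 →₀ ℕ)).degree : ℤ) = s := by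
      rw [Finsupp.degree_eq_sum, hm]
      simp
    simpa using h ⟨_, hdeg⟩ (Finset.mem_univ _)
  · rintro h ⟨d, hd⟩ -
    rw [if_neg]
    rintro ⟨h1, h2⟩
    refine h ⟨d 0, ?_⟩
    rw [← show (d.degree : ℤ) = s from hd, Finsupp.degree_eq_sum, Fin.sum_univ_three, ← h2, ← h1]
    push_cast
    ring

/-! ### Cyclic indices -/

theorem fin_three_cyclic (k : Fin 3) :
    k + 1 + 1 = k + 2 ∧ k + 1 + 2 = k ∧ k + 2 + 1 = k ∧ k + 2 + 2 = k + 1 ∧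
      (finRotate 3).symm k = k + 2 ∧ finRotate 3 k = k + 1 := by
  revert k
  decide

theorem sum_cyclic {M : Type*} [AddCommMonoid M] (F : Fin 3 → M) (k : Fin 3) :
    ∑ i, F i = F k + F (k + 1) + F (k + 2) := by
  rw [← Equiv.sum_comp (Equiv.addLeft k), Fin.sum_univ_three]
  simp

/-! ### One-forms on the triangle -/

/-- The one-form `f₀ dλ₀ + f₁ dλ₁ + f₂ dλ₂` on the triangle. -/
noncomputable def oneForm : (Fin 3 → MvPolynomial (Fin 3) ℝ) →ₗ[ℝ] SimplexForm 1 2 where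
  toFun f x := AlternatingMap.ofSubsingleton ℝ (tangent 2) ℝ (0 : Fin 1)
    ((∑ i, eval x.1 (f i) • (LinearMap.proj i : (Fin 3 → ℝ) →ₗ[ℝ] ℝ)) ∘ₗ (tangent 2).subtype)
  map_add' f g := by
    funext x
    ext v
    simp [add_mul, Finset.sum_add_distrib]
  map_smul' c f := by
    funext x
    ext v
    simp [Finset.mul_sum, mul_assoc]

theorem oneForm_apply (f : Fin 3 → MvPolynomial (Fin 3) ℝ) (x : Simplex 2)
    (v : Fin 1 → tangent 2) : oneForm f x v = ∑ i, eval x.1 (f i) * (v 0).1 i := by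
  simp [oneForm]

/-- The edge vector of the triangle parallel to the facet opposite to the vertex `k`. -/
def edgeVec (k : Fin 3) : tangent 2 :=
  ⟨fun i => if i = k + 1 then 1 else if i = k + 2 then -1 else 0, by
    change ∑ i, _ = (0 : ℝ)
    rw [sum_cyclic _ k]
    fin_cases k <;> simp⟩

theorem oneForm_edgeVec (f : Fin 3 → MvPolynomial (Fin 3) ℝ) (x : Simplex 2) (k : Fin 3) :
    oneForm f x (fun _ => edgeVec k) = eval x.1 (f (k + 1)) - eval x.1 (f (k + 2)) := by
  rw [oneForm_apply, sum_cyclic _ k]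
  simp [edgeVec]
  ring

/-- On the triangle the only relation is `dλ₀ + dλ₁ + dλ₂ = 0`. Edge vectors detect it pointwise,
and the common degree turns equality on the simplex into equality of polynomials. -/
theorem oneForm_eq_zero_iff {r : ℤ} {f : Fin 3 → MvPolynomial (Fin 3) ℝ}
    (hf : ∀ i, f i ∈ homog r) : oneForm f = 0 ↔ ∀ k, f (k + 1) = f (k + 2) := by
  constructor
  · intro h k
    rw [← sub_eq_zero]
    refine eq_zero_of_simplex (sub_mem (hf _) (hf _)) fun x => ?_
    rw [map_sub, ← oneForm_edgeVec, h]
    rfl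
  · intro h
    funext x
    ext v
    have h1 : f 1 = f 2 := h 0
    have h2 : f 2 = f 0 := h 1
    have hv : (v 0).1 0 + (v 0).1 1 + (v 0).1 2 = 0 := (Fin.sum_univ_three _).symm.trans (v 0).2
    rw [oneForm_apply, Fin.sum_univ_three, h1, h2, ← mul_add, ← mul_add, hv, mul_zero]
    rfl

theorem pullbackRep_oneForm (f : Fin 3 → MvPolynomial (Fin 3) ℝ) :
    pullbackRep 1 2 (finRotate 3) (oneForm f) =
      oneForm fun j => rename (finRotate 3) (f ((finRotate 3).symm j)) := by
  funext x
  ext v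
  change oneForm f (permSimplex (finRotate 3) x) (fun a => permTangent (finRotate 3) (v a)) = _
  rw [oneForm_apply, oneForm_apply, ← Equiv.sum_comp (finRotate 3)]
  conv_rhs => rw [← Equiv.sum_comp (finRotate 3), ← Equiv.sum_comp (finRotate 3)]
  refine Finset.sum_congr rfl fun i _ => ?_
  rw [eval_rename, Equiv.symm_apply_apply]
  rfl

/-- The tangent line of facet `k` is spanned by `edgeVec k`. -/
theorem oneForm_mem_traceFree_iff {f : Fin 3 → MvPolynomial (Fin 3) ℝ} :
    oneForm f ∈ (traceFree 1 2).toSubmodule ↔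
      ∀ k, ∀ x : Simplex 2, x.1 k = 0 → eval x.1 (f (k + 1)) = eval x.1 (f (k + 2)) := by
  simp only [traceFree, Submodule.mem_iInf, LinearMap.mem_ker]
  refine forall_congr' fun k => ⟨fun h x hx => ?_, fun h => ?_⟩
  · have hk : edgeVec k ∈ facetTangent 2 k := by
      change (if k = k + 1 then (1 : ℝ) else if k = k + 2 then -1 else 0) = 0
      fin_cases k <;> simp
    have h1 : oneForm f x (fun _ => edgeVec k) = 0 :=
      DFunLike.congr_fun (congrFun h ⟨x, hx⟩) fun _ : Fin 1 => (⟨edgeVec k, hk⟩ : facetTangent 2 k)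
    rwa [oneForm_edgeVec, sub_eq_zero] at h1
  · funext x
    ext v
    change oneForm f x.1 (fun a => (v a).1) = 0
    have hv : ∑ i, (v 0).1.1 i = 0 := (v 0).1.2
    have hvk : (v 0).1.1 k = 0 := (v 0).2
    rw [sum_cyclic _ k, hvk] at hv
    rw [oneForm_apply, sum_cyclic _ k, hvk, h x.1 x.2]
    linear_combination eval x.1.1 (f (k + 2)) * hv

theorem mem_P_iff {r : ℤ} {ω : SimplexForm 1 2} :
    ω ∈ (P r 1 2).toSubmodule ↔ ∃ f : Fin 3 → homog r, oneForm (fun i => f i) = ω := by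
  constructor
  · rintro ⟨η, hη, rfl⟩
    choose p hp hp' using fun i : Fin 3 => hη fun _ => i
    choose q hq hq' using fun i => exists_homogenization (hp i)
    refine ⟨fun i => ⟨q i, hq i⟩, ?_⟩
    funext x
    ext v
    change _ = η x.1 (fun a => (v a).1)
    rw [oneForm_apply]
    simp only [hq', ← hp']
    have h1 : (fun a => (v a).1) = fun _ : Fin 1 => ∑ i, (v 0).1 i • (Pi.single i 1 : Fin 3 → ℝ) := by
      funext a
      rw [Subsingleton.elim a 0]
      exact pi_eq_sum_univ' _
    have h2 : ∀ w : Fin 3 → ℝ, η x.1 (fun _ => w) =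
        (AlternatingMap.ofSubsingleton ℝ (Fin 3 → ℝ) ℝ (0 : Fin 1)).symm (η x.1) w := fun w => rfl
    rw [h1, h2, map_sum]
    refine Finset.sum_congr rfl fun i _ => ?_
    rw [map_smul, smul_eq_mul, mul_comm, h2]
  · rintro ⟨f, rfl⟩
    refine ⟨fun x => AlternatingMap.ofSubsingleton ℝ (Fin 3 → ℝ) ℝ (0 : Fin 1)
      (∑ i, eval x (f i).1 • (LinearMap.proj i : (Fin 3 → ℝ) →ₗ[ℝ] ℝ)), fun I => ⟨f (I 0), ?_, ?_⟩, ?_⟩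
    · exact fun d hd => (mem_homog.1 (f (I 0)).2 d (mem_support_iff.1 hd)).le
    · intro x
      simp [Pi.single_apply]
    · rfl

/-! ### Contraction with the position field as a cross product -/

/-- The coefficients of the contraction with the position vector field of the 2-form
`g₀ dλ₁ ∧ dλ₂ + g₁ dλ₂ ∧ dλ₀ + g₂ dλ₀ ∧ dλ₁`. -/
noncomputable def crossX :
    (Fin 3 → MvPolynomial (Fin 3) ℝ) →ₗ[ℝ] (Fin 3 → MvPolynomial (Fin 3) ℝ) where
  toFun g j := X (j + 2) * g (j + 1) - X (j + 1) * g (j + 2)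
  map_add' f g := by
    funext j
    simp only [Pi.add_apply]
    ring
  map_smul' c g := by
    funext j
    simp [smul_sub]

theorem crossX_apply (g : Fin 3 → MvPolynomial (Fin 3) ℝ) (j : Fin 3) :
    crossX g j = X (j + 2) * g (j + 1) - X (j + 1) * g (j + 2) := rfl

theorem crossX_mem_homog {r : ℤ} (g : Fin 3 → homog (r - 1)) (j : Fin 3) :
    crossX (fun i => g i) j ∈ homog r := by
  have h := fun i k : Fin 3 => X_mul_mem_homog (i := i) (g k).2
  rw [sub_add_cancel] at h
  exact sub_mem (h _ _) (h _ _)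

/-- A 3-cycle is even, so the cross product commutes with it without a sign. -/
theorem crossX_rename (g : Fin 3 → MvPolynomial (Fin 3) ℝ) :
    crossX (fun j => rename (finRotate 3) (g ((finRotate 3).symm j))) =
      fun j => rename (finRotate 3) (crossX g ((finRotate 3).symm j)) := by
  funext j
  obtain ⟨h1, h2, h3, h4, h5, -⟩ := fin_three_cyclic j
  rw [crossX_apply, crossX_apply, h5, (fin_three_cyclic (j + 1)).2.2.2.2.1,
    (fin_three_cyclic (j + 2)).2.2.2.2.1, map_sub, map_mul, map_mul, rename_X, rename_X,
    (fin_three_cyclic _).2.2.2.2.2, (fin_three_cyclic _).2.2.2.2.2, h2, h3, h4, h1]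

/-- A form in the kernel of restriction has three equal coefficients `c`. Contracting twice with `X`
gives zero, so `(X 0 + X 1 + X 2) c = 0` and `c = 0`: restriction loses nothing on contractions. -/
theorem oneForm_crossX_eq_zero_iff {r : ℤ} (g : Fin 3 → homog (r - 1)) :
    oneForm (crossX fun i => g i) = 0 ↔ crossX (fun i => (g i : MvPolynomial (Fin 3) ℝ)) = 0 := by
  refine ⟨fun h => ?_, fun h => by rw [h, map_zero]⟩
  rw [oneForm_eq_zero_iff (crossX_mem_homog g)] at h
  have h1 : crossX (fun i => (g i : MvPolynomial (Fin 3) ℝ)) 1 = _ := h 0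
  have h2 : crossX (fun i => (g i : MvPolynomial (Fin 3) ℝ)) 2 = _ := h 1
  have h0 : (X 0 + X 1 + X 2) * crossX (fun i => (g i : MvPolynomial (Fin 3) ℝ)) 0 = 0 := by
    have e : ∑ i, X i * crossX (fun i => (g i : MvPolynomial (Fin 3) ℝ)) i = 0 := by
      simp only [crossX_apply, Fin.sum_univ_three, Fin.reduceAdd, zero_add]
      ring
    rw [Fin.sum_univ_three] at e
    simp only [Fin.reduceAdd, zero_add] at h1 h2
    rw [h1, h2] at e
    linear_combination e
  have hX : (X 0 + X 1 + X 2 : MvPolynomial (Fin 3) ℝ) ≠ 0 := fun h => by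
    have := congrArg (eval fun _ => (1 : ℝ)) h
    norm_num at this
  have h0' := (mul_eq_zero.1 h0).resolve_left hX
  funext k
  fin_cases k
  · exact h0'
  · exact h1.trans (h2.trans h0')
  · exact h2.trans h0'

theorem curryLeft_det_apply (c : Fin 3 → ℝ) (w : Fin 2 → Fin 3 → ℝ) :
    Matrix.detRowAlternating.curryLeft c w =
      ∑ k, c k * (w 0 (k + 1) * w 1 (k + 2) - w 0 (k + 2) * w 1 (k + 1)) := by
  change Matrix.det (Matrix.of (Fin.cons c w : Fin 3 → Fin 3 → ℝ)) = _
  rw [Matrix.det_fin_three]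
  change c 0 * w 0 1 * w 1 2 - c 0 * w 0 2 * w 1 1 - c 1 * w 0 0 * w 1 2 + c 1 * w 0 2 * w 1 0 +
    c 2 * w 0 0 * w 1 1 - c 2 * w 0 1 * w 1 0 = _
  simp only [Fin.sum_univ_three, Fin.reduceAdd, zero_add]
  ring

/-- Alternating 2-forms on `ℝ³` are contractions of the determinant. -/
theorem alternating_two_eq (β : (Fin 3 → ℝ) [⋀^Fin 2]→ₗ[ℝ] ℝ) :
    β = Matrix.detRowAlternating.curryLeft
      (fun k : Fin 3 => β fun a => Pi.single ((![k + 1, k + 2] : Fin 2 → Fin 3) a) 1) := by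
  refine Module.Basis.ext_alternating (Pi.basisFun ℝ (Fin 3)) fun I hI => ?_
  simp only [Pi.basisFun_apply]
  obtain ⟨i, j, rfl⟩ : ∃ i j, I = ![i, j] := ⟨I 0, I 1, by
    funext a
    fin_cases a <;> rfl⟩
  have hij : j = i + 1 ∨ j = i + 2 := by
    have : i ≠ j := fun h => by
      have := @hI 0 1 h
      simp at this
    revert i j
    decide
  rw [curryLeft_det_apply]
  rcases hij with rfl | rfl
  · fin_cases i <;> simp [Fin.sum_univ_three]
  · have hswap : (β fun a => Pi.single ((![i, i + 2] : Fin 2 → Fin 3) a) 1) =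
        -β fun a => Pi.single ((![i + 2, i] : Fin 2 → Fin 3) a) 1 := by
      rw [← β.map_swap _ (zero_ne_one (α := Fin 2))]
      congr 1
      funext a
      fin_cases a <;> rfl
    rw [hswap]
    fin_cases i <;> simp [Fin.sum_univ_three]

theorem mem_PMinus_iff {r : ℤ} {ω : SimplexForm 1 2} :
    ω ∈ (PMinus r 1 2).toSubmodule ↔
      ∃ g : Fin 3 → homog (r - 1), oneForm (crossX fun i => g i) = ω := by
  constructor
  · rintro ⟨_, ⟨α, hα, rfl⟩, rfl⟩
    choose p hp hp' using fun k : Fin 3 => hα ![k + 1, k + 2]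
    choose q hq hq' using fun i => exists_homogenization (hp i)
    refine ⟨fun i => ⟨q i, hq i⟩, ?_⟩
    funext x
    ext v
    change _ = α x.1 (Fin.cons x.1 (fun a => (v a).1))
    rw [alternating_two_eq (α x.1), oneForm_apply]
    refine Eq.trans ?_ (curryLeft_det_apply _ _).symm
    simp only [hp', ← hq', crossX_apply, map_sub, map_mul, eval_X, Fin.sum_univ_three,
      Fin.reduceAdd, zero_add]
    change _ = eval x.1 (q 0) * (x.1 1 * (v 0).1 2 - x.1 2 * (v 0).1 1) +
      eval x.1 (q 1) * (x.1 2 * (v 0).1 0 - x.1 0 * (v 0).1 2) +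
      eval x.1 (q 2) * (x.1 0 * (v 0).1 1 - x.1 1 * (v 0).1 0)
    ring
  · rintro ⟨g, rfl⟩
    refine ⟨_, ⟨fun x => Matrix.detRowAlternating.curryLeft (fun k => eval x (g k).1),
      fun I => ?_, rfl⟩, ?_⟩
    · let a : Fin 3 → ℝ := Pi.single (I 0) 1
      let b : Fin 3 → ℝ := Pi.single (I 1) 1
      -- These are the 2×2 minors from expanding the determinant along its first row.
      refine ⟨∑ k, (a (k + 1) * b (k + 2) - a (k + 2) * b (k + 1)) • (g k).1, fun d hd => ?_,
        fun x => ?_⟩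
      · have h : ∑ k, (a (k + 1) * b (k + 2) - a (k + 2) * b (k + 1)) • (g k).1 ∈ homog (r - 1) :=
          Submodule.sum_mem _ fun k _ => Submodule.smul_mem _ _ (g k).2
        exact (mem_homog.1 h d (mem_support_iff.1 hd)).le
      · refine (curryLeft_det_apply _ _).trans ?_
        rw [map_sum]
        refine Finset.sum_congr rfl fun k _ => ?_
        rw [smul_eval, mul_comm]
    · funext x
      ext v
      rw [oneForm_apply]
      refine (curryLeft_det_apply _ _).trans ?_
      simp only [crossX_apply, map_sub, map_mul, eval_X, Fin.sum_univ_three,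
        Fin.reduceAdd, zero_add]
      change eval x.1 (g 0).1 * (x.1 1 * (v 0).1 2 - x.1 2 * (v 0).1 1) +
        eval x.1 (g 1).1 * (x.1 2 * (v 0).1 0 - x.1 0 * (v 0).1 2) +
        eval x.1 (g 2).1 * (x.1 0 * (v 0).1 1 - x.1 1 * (v 0).1 0) = _
      ring

/-! ### The four spaces as subquotients of triples of homogeneous polynomials -/

section Subrep

variable {G M K V Q : Type*} [Group G] [AddCommGroup M] [Module ℝ M] [AddCommGroup K] [Module ℝ K]
  [AddCommGroup V] [Module ℝ V] [AddCommGroup Q] [Module ℝ Q]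
  [Module.Finite ℝ K] [Module.Finite ℝ V] [Module.Finite ℝ Q] {ρ : Representation ℝ G M}

/-- The trace on a subrepresentation presented as a quotient of `V` by `K`. -/
theorem finite_and_trace_of_quotient (W : Subrepresentation ρ) (g : G) {i : K →ₗ[ℝ] V}
    {Φ : V →ₗ[ℝ] M} {a : K →ₗ[ℝ] K} {b : V →ₗ[ℝ] V} (hi : Function.Injective i)
    (hW : ∀ ω, ω ∈ W.toSubmodule ↔ ∃ v, Φ v = ω) (hker : ∀ v, Φ v = 0 ↔ ∃ y, i y = v)
    (hab : ∀ y, b (i y) = i (a y)) (hb : ∀ v, Φ (b v) = ρ g (Φ v)) :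
    Module.Finite ℝ W.toSubmodule ∧
      LinearMap.trace ℝ _ (W.toRepresentation g) =
        LinearMap.trace ℝ V b - LinearMap.trace ℝ K a := by
  let φ : V →ₗ[ℝ] W.toSubmodule := Φ.codRestrict _ fun v => (hW _).2 ⟨v, rfl⟩
  have hsurj : Function.Surjective φ := fun ⟨ω, hω⟩ => by
    obtain ⟨v, rfl⟩ := (hW ω).1 hω
    exact ⟨v, rfl⟩
  have hfin := Module.Finite.of_surjective φ hsurj
  refine ⟨hfin, ?_⟩
  rw [trace_add_trace_of_exact (c := W.toRepresentation g) hi hsurj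
    (fun v => Subtype.ext_iff.trans (hker v)) hab (fun v => Subtype.ext (hb v)),
    add_sub_cancel_left]

/-- The trace on a subrepresentation presented as the kernel of a surjection `V → Q`. -/
theorem finite_and_trace_of_kernel (W : Subrepresentation ρ) (g : G) {ψ : V →ₗ[ℝ] Q}
    {Φ : V →ₗ[ℝ] M} {b : V →ₗ[ℝ] V} {c : Q →ₗ[ℝ] Q} (hψ : Function.Surjective ψ)
    (hW : ∀ ω, ω ∈ W.toSubmodule ↔ ∃ v, ψ v = 0 ∧ Φ v = ω)
    (hinj : ∀ v, ψ v = 0 → Φ v = 0 → v = 0)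
    (hbc : ∀ v, ψ (b v) = c (ψ v)) (hb : ∀ v, Φ (b v) = ρ g (Φ v)) :
    Module.Finite ℝ W.toSubmodule ∧
      LinearMap.trace ℝ _ (W.toRepresentation g) =
        LinearMap.trace ℝ V b - LinearMap.trace ℝ Q c := by
  have hbker : ∀ v ∈ LinearMap.ker ψ, b v ∈ LinearMap.ker ψ := fun v hv => by
    rw [LinearMap.mem_ker, hbc, LinearMap.mem_ker.1 hv, map_zero]
  -- The kernel of `ψ` maps isomorphically onto `W`: a quotient presentation with no relations.
  obtain ⟨hfin, h⟩ := finite_and_trace_of_quotient W g (i := (0 : PUnit →ₗ[ℝ] LinearMap.ker ψ))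
    (Φ := Φ ∘ₗ (LinearMap.ker ψ).subtype) (a := 0) (b := b.restrict hbker)
    (Function.injective_of_subsingleton _)
    (fun ω => (hW ω).trans ⟨fun ⟨v, hv, hv'⟩ => ⟨⟨v, hv⟩, hv'⟩, fun ⟨v, hv⟩ => ⟨v.1, v.2, hv⟩⟩)
    (fun v => ⟨fun hv => ⟨0, (Subtype.ext (hinj v.1 v.2 hv)).symm⟩, by
      rintro ⟨y, rfl⟩
      exact map_zero _⟩)
    (fun _ => map_zero _) (fun v => hb v.1)
  refine ⟨hfin, ?_⟩
  rw [h, map_zero, sub_zero, trace_add_trace_of_exact (i := (LinearMap.ker ψ).subtype)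
    (a := b.restrict hbker) Subtype.val_injective hψ
    (fun v => ⟨fun hv => ⟨⟨v, hv⟩, rfl⟩, by
      rintro ⟨y, rfl⟩
      exact y.2⟩) (fun _ => rfl) hbc, add_sub_cancel_right]

end Subrep

section Resolutions

variable {r : ℤ}

/-- Triples of homogeneous polynomials as triples of polynomials. -/
noncomputable def tripleCoe (s : ℤ) :
    (Fin 3 → homog s) →ₗ[ℝ] (Fin 3 → MvPolynomial (Fin 3) ℝ) :=
  (homog s).subtype.compLeft (Fin 3)

theorem tripleCoe_apply {s : ℤ} (f : Fin 3 → homog s) (i : Fin 3) : tripleCoe s f i = f i := rfl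

theorem tripleCoe_rotTriple {s : ℤ} (f : Fin 3 → homog s) :
    tripleCoe s (rotTriple s f) =
      fun j => rename (finRotate 3) (tripleCoe s f ((finRotate 3).symm j)) := rfl

/-! ### The space `𝒫_r Λ¹`: triples modulo the diagonal -/

/-- The diagonal embedding of homogeneous polynomials into triples. -/
noncomputable def diagTriple (s : ℤ) : homog s →ₗ[ℝ] (Fin 3 → homog s) :=
  LinearMap.pi fun _ => LinearMap.id

theorem diagTriple_injective (s : ℤ) : Function.Injective (diagTriple s) :=
  fun _ _ h => congrFun h 0

theorem exists_diagTriple_eq_iff {s : ℤ} {f : Fin 3 → homog s} :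
    (∃ y, diagTriple s y = f) ↔ ∀ k, (f (k + 1) : MvPolynomial (Fin 3) ℝ) = f (k + 2) := by
  constructor
  · rintro ⟨y, rfl⟩ k
    rfl
  · intro h
    have h1 : f 1 = f 2 := Subtype.ext (h 0)
    have h2 : f 2 = f 0 := Subtype.ext (h 1)
    refine ⟨f 0, ?_⟩
    funext i
    fin_cases i
    exacts [rfl, (h1.trans h2).symm, h2.symm]

theorem mem_homog_of_eq {s t : ℤ} {p : MvPolynomial (Fin 3) ℝ} (hp : p ∈ homog s) (h : s = t) :
    p ∈ homog t := h ▸ hp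

theorem finite_and_trace_P (r : ℤ) : Module.Finite ℝ (P r 1 2).toSubmodule ∧
    LinearMap.trace ℝ _ ((P r 1 2).toRepresentation (finRotate 3)) =
      -LinearMap.trace ℝ _ (rot r) := by
  rw [← zero_sub, ← trace_rotTriple r]
  exact finite_and_trace_of_quotient (P r 1 2) (finRotate 3) (Φ := oneForm ∘ₗ tripleCoe r)
    (diagTriple_injective r) (fun ω => mem_P_iff)
    (fun f => (oneForm_eq_zero_iff fun i => (f i).2).trans exists_diagTriple_eq_iff.symm)
    (fun _ => rfl) (fun f => (pullbackRep_oneForm (tripleCoe r f)).symm)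

/-! ### The space `𝒫_r⁻ Λ¹`: a Koszul sequence -/

/-- Multiplication of the position vector field by a homogeneous polynomial. -/
noncomputable def radial (s : ℤ) : homog s →ₗ[ℝ] (Fin 3 → homog (s + 1)) where
  toFun q i := ⟨X i * q.1, X_mul_mem_homog q.2⟩
  map_add' p q := by
    funext i
    exact Subtype.ext (mul_add _ _ _)
  map_smul' c q := by
    funext i
    exact Subtype.ext (mul_smul_comm _ _ _)

theorem radial_injective (s : ℤ) : Function.Injective (radial s) := fun _ _ h =>
  Subtype.ext (mul_left_cancel₀ (X_ne_zero (0 : Fin 3)) (congrArg Subtype.val (congrFun h 0)))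

/-- Koszul exactness: a field parallel to `X` is a polynomial multiple of it. From `X 1 * g 0 = X 0
* g 1` the prime `X 0` divides `g 0`, and the quotient is the multiplier. -/
theorem crossX_eq_zero_iff {s : ℤ} {g : Fin 3 → homog (s + 1)} :
    crossX (tripleCoe _ g) = 0 ↔ ∃ q, radial s q = g := by
  constructor
  · intro h
    have h1 : X 0 * (g 2).1 = X 2 * (g 0).1 := sub_eq_zero.1 (congrFun h 1)
    have h2 : X 1 * (g 0).1 = X 0 * (g 1).1 := sub_eq_zero.1 (congrFun h 2)
    obtain ⟨q, hq⟩ : X 0 ∣ (g 0).1 :=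
      (X_dvd_mul_iff.1 (Dvd.intro _ h2.symm)).resolve_left fun h => by
        simp [X_dvd_X] at h
    have hqm : q ∈ homog s := by
      have := (g 0).2
      rw [hq, X_mul_mem_homog_iff] at this
      simpa using this
    have hX : (X 0 : MvPolynomial (Fin 3) ℝ) ≠ 0 := X_ne_zero 0
    refine ⟨⟨q, hqm⟩, ?_⟩
    funext i
    refine Subtype.ext ?_
    change X i * q = _
    fin_cases i
    · exact hq.symm
    · refine mul_left_cancel₀ hX ?_
      change X 0 * (X 1 * q) = X 0 * (g 1).1
      rw [← h2, hq]
      ring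
    · refine mul_left_cancel₀ hX ?_
      change X 0 * (X 2 * q) = X 0 * (g 2).1
      rw [h1, hq]
      ring
  · rintro ⟨q, rfl⟩
    funext j
    change X (j + 2) * (X (j + 1) * q.1) - X (j + 1) * (X (j + 2) * q.1) = 0
    ring

theorem finite_and_trace_PMinus (r : ℤ) : Module.Finite ℝ (PMinus r 1 2).toSubmodule ∧
    LinearMap.trace ℝ _ ((PMinus r 1 2).toRepresentation (finRotate 3)) =
      -LinearMap.trace ℝ _ (rot (r - 2)) := by
  obtain ⟨s, rfl⟩ : ∃ s, r = s + 1 + 1 := ⟨r - 1 - 1, by ring⟩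
  rw [show s + 1 + 1 - 2 = s by ring]
  have hs : s + 1 = s + 1 + 1 - 1 := by ring
  have hrad : ∀ q, rotTriple (s + 1) (radial s q) = radial s (rot s q) := fun q => by
    funext j
    refine Subtype.ext ?_
    change rename (finRotate 3) (X ((finRotate 3).symm j) * q.1) = X j * rename (finRotate 3) q.1
    rw [map_mul, rename_X, Equiv.apply_symm_apply]
  rw [← zero_sub, ← trace_rotTriple (s + 1)]
  refine finite_and_trace_of_quotient (PMinus (s + 1 + 1) 1 2) (finRotate 3)
    (Φ := oneForm ∘ₗ crossX ∘ₗ tripleCoe (s + 1)) (radial_injective s) (fun ω => ?_) (fun g => ?_)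
    hrad (fun g => ?_)
  · rw [mem_PMinus_iff]
    exact ⟨fun ⟨g, hg⟩ => ⟨fun i => ⟨(g i).1, mem_homog_of_eq (g i).2 hs.symm⟩, hg⟩,
      fun ⟨g, hg⟩ => ⟨fun i => ⟨(g i).1, mem_homog_of_eq (g i).2 hs⟩, hg⟩⟩
  · rw [← crossX_eq_zero_iff]
    exact oneForm_crossX_eq_zero_iff (r := s + 1 + 1)
      fun i => ⟨(g i).1, mem_homog_of_eq (g i).2 hs⟩
  · simp only [LinearMap.comp_apply]
    rw [pullbackRep_oneForm, tripleCoe_rotTriple, crossX_rename]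

/-! ### The space `𝒫̊_r⁻ Λ¹` -/

/-- Multiplication of the `k`-th entry of a triple by the `k`-th variable. -/
noncomputable def mulX (s : ℤ) : (Fin 3 → homog s) →ₗ[ℝ] (Fin 3 → homog (s + 1)) where
  toFun q i := ⟨X i * (q i).1, X_mul_mem_homog (q i).2⟩
  map_add' p q := by
    funext i
    exact Subtype.ext (mul_add _ _ _)
  map_smul' c q := by
    funext i
    exact Subtype.ext (mul_smul_comm _ _ _)

theorem coe_mulX {s : ℤ} (q : Fin 3 → homog s) (i : Fin 3) :
    (mulX s q i : MvPolynomial (Fin 3) ℝ) = X i * (q i).1 := rfl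

theorem mulX_rotTriple {s : ℤ} (q : Fin 3 → homog s) :
    mulX s (rotTriple s q) = rotTriple (s + 1) (mulX s q) := by
  funext j
  refine Subtype.ext ?_
  change X j * rename (finRotate 3) (q ((finRotate 3).symm j)).1 =
    rename (finRotate 3) (X ((finRotate 3).symm j) * (q ((finRotate 3).symm j)).1)
  rw [map_mul, rename_X, Equiv.apply_symm_apply]

theorem crossX_mulX_eq_zero_iff {s : ℤ} {q : Fin 3 → homog s} :
    crossX (tripleCoe _ (mulX s q)) = 0 ↔
      ∀ k, (q (k + 1) : MvPolynomial (Fin 3) ℝ) = q (k + 2) := by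
  rw [funext_iff]
  refine forall_congr' fun k => ?_
  have h : crossX (tripleCoe _ (mulX s q)) k =
      (X (k + 1) * X (k + 2)) * ((q (k + 1)).1 - (q (k + 2)).1) := by
    rw [crossX_apply, tripleCoe_apply, tripleCoe_apply, coe_mulX, coe_mulX]
    ring
  rw [h, Pi.zero_apply, mul_eq_zero, sub_eq_zero,
    or_iff_right (mul_ne_zero (X_ne_zero _) (X_ne_zero _))]

/-- Where `λ_k = 0`, the difference of coefficients tested on facet `k` is `-(λ_{k+1} + λ_{k+2}) g_k
= -g_k`. Hence trace-free contractions are those with `g_k` divisible by `λ_k`. -/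
theorem oneForm_crossX_mem_traceFree_iff {g : Fin 3 → MvPolynomial (Fin 3) ℝ} :
    oneForm (crossX g) ∈ (traceFree 1 2).toSubmodule ↔
      ∀ k, ∀ x : Simplex 2, x.1 k = 0 → eval x.1 (g k) = 0 := by
  rw [oneForm_mem_traceFree_iff]
  refine forall_congr' fun k => forall_congr' fun x => forall_congr' fun hx => ?_
  obtain ⟨h1, h2, h3, h4, -, -⟩ := fin_three_cyclic k
  have hsum : x.1 (k + 1) + x.1 (k + 2) = 1 := by
    have : ∑ i, x.1 i = 1 := x.2.2
    rwa [sum_cyclic _ k, hx, zero_add] at this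
  rw [crossX_apply, crossX_apply, h1, h2, h3, h4, ← sub_eq_zero]
  simp only [map_sub, map_mul, eval_X, hx]
  rw [show 0 * eval x.1 (g (k + 2)) - x.1 (k + 2) * eval x.1 (g k) -
    (x.1 (k + 1) * eval x.1 (g k) - 0 * eval x.1 (g (k + 1))) =
    -((x.1 (k + 1) + x.1 (k + 2)) * eval x.1 (g k)) by ring, hsum, one_mul, neg_eq_zero]

theorem finite_and_trace_PMinusTraceFree (r : ℤ) :
    Module.Finite ℝ (PMinusTraceFree r 1 2).toSubmodule ∧
    LinearMap.trace ℝ _ ((PMinusTraceFree r 1 2).toRepresentation (finRotate 3)) =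
      -LinearMap.trace ℝ _ (rot (r - 2)) := by
  obtain ⟨s, rfl⟩ : ∃ s, r = s + 1 + 1 := ⟨r - 1 - 1, by ring⟩
  rw [show s + 1 + 1 - 2 = s by ring]
  have hs : s + 1 = s + 1 + 1 - 1 := by ring
  rw [← zero_sub, ← trace_rotTriple s]
  refine finite_and_trace_of_quotient (PMinusTraceFree (s + 1 + 1) 1 2) (finRotate 3)
    (Φ := oneForm ∘ₗ crossX ∘ₗ tripleCoe (s + 1) ∘ₗ mulX s) (diagTriple_injective s) (fun ω => ?_)
    (fun q => ?_) (fun _ => rfl) (fun q => ?_)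
  · constructor
    · rintro ⟨hω, hω'⟩
      obtain ⟨g, rfl⟩ := mem_PMinus_iff.1 hω
      choose q hq hq' using fun k =>
        exists_eq_X_mul_of_facet (g k).2 (oneForm_crossX_mem_traceFree_iff.1 hω' k)
      rw [show s + 1 + 1 - 1 - 1 = s by ring] at hq
      refine ⟨fun k => ⟨q k, hq k⟩, congrArg (fun f => oneForm (crossX f)) ?_⟩
      funext k
      exact (hq' k).symm
    · rintro ⟨q, rfl⟩
      refine ⟨mem_PMinus_iff.2 ⟨fun i => ⟨(mulX s q i).1, mem_homog_of_eq (mulX s q i).2 hs⟩, rfl⟩,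
        oneForm_crossX_mem_traceFree_iff.2 fun k x hx => ?_⟩
      rw [LinearMap.comp_apply, tripleCoe_apply, coe_mulX, map_mul, eval_X, hx, zero_mul]
  · rw [exists_diagTriple_eq_iff, ← crossX_mulX_eq_zero_iff]
    exact oneForm_crossX_eq_zero_iff (r := s + 1 + 1)
      fun i => ⟨(mulX s q i).1, mem_homog_of_eq (mulX s q i).2 hs⟩
  · simp only [LinearMap.comp_apply]
    rw [pullbackRep_oneForm, mulX_rotTriple, tripleCoe_rotTriple, crossX_rename]

/-! ### The space `𝒫̊_r Λ¹`: a kernel rather than a quotient -/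

/-- The sum of the entries of a triple. -/
noncomputable def sumTriple (s : ℤ) : (Fin 3 → homog s) →ₗ[ℝ] homog s :=
  ∑ i, LinearMap.proj i

theorem sumTriple_apply {s : ℤ} (f : Fin 3 → homog s) : sumTriple s f = ∑ i, f i := by
  simp [sumTriple]

theorem sumTriple_rotTriple {s : ℤ} (f : Fin 3 → homog s) :
    sumTriple s (rotTriple s f) = rot s (sumTriple s f) := by
  rw [sumTriple_apply, sumTriple_apply, map_sum]
  exact Equiv.sum_comp (finRotate 3).symm fun j => rot s (f j)

/-- A primitive of a cyclic difference: if the entries of `f` sum to zero, then the difference of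
the entries `k + 1` and `k + 2` of the result is `f k`. -/
noncomputable def cyclicPrimitive (s : ℤ) : (Fin 3 → homog s) →ₗ[ℝ] (Fin 3 → homog s) :=
  LinearMap.pi fun j : Fin 3 => (1 / 3 : ℝ) •
    ((LinearMap.proj (j + 2) : (Fin 3 → homog s) →ₗ[ℝ] homog s) - LinearMap.proj (j + 1))

theorem cyclicPrimitive_apply {s : ℤ} (f : Fin 3 → homog s) (j : Fin 3) :
    cyclicPrimitive s f j = (1 / 3 : ℝ) • (f (j + 2) - f (j + 1)) := rfl

theorem cyclicPrimitive_sub {s : ℤ} {f : Fin 3 → homog s} (hf : sumTriple s f = 0) (k : Fin 3) :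
    cyclicPrimitive s f (k + 1) - cyclicPrimitive s f (k + 2) = f k := by
  obtain ⟨h1, h2, h3, h4, -, -⟩ := fin_three_cyclic k
  rw [sumTriple_apply, sum_cyclic _ k] at hf
  rw [cyclicPrimitive_apply, cyclicPrimitive_apply, h1, h2, h3, h4]
  linear_combination (norm := module) (-(1 / 3 : ℝ)) • hf

/-- Equivariance is the reason for the symmetric primitive with factor `1/3`. -/
theorem cyclicPrimitive_rotTriple {s : ℤ} (f : Fin 3 → homog s) :
    cyclicPrimitive s (rotTriple s f) = rotTriple s (cyclicPrimitive s f) := by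
  funext j
  obtain ⟨h1, h2, h3, h4, h5, -⟩ := fin_three_cyclic j
  rw [rotTriple_apply, cyclicPrimitive_apply, cyclicPrimitive_apply, map_smul, map_sub,
    rotTriple_apply, rotTriple_apply, h5, (fin_three_cyclic (j + 1)).2.2.2.2.1,
    (fin_three_cyclic (j + 2)).2.2.2.2.1, h2, h3]

/-- Every monomial of positive degree is divisible by a variable; only constants, in degree zero,
are missed. -/
theorem sumTriple_mulX_surjective {s : ℤ} (hs : s + 1 ≠ 0) :
    Function.Surjective (sumTriple (s + 1) ∘ₗ mulX s) := by
  have hle : homog (s + 1) ≤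
      (LinearMap.range (sumTriple (s + 1) ∘ₗ mulX s)).map (homog (s + 1)).subtype := by
    conv_lhs => rw [homog, restrictSupport_eq_span]
    rw [Submodule.span_le]
    rintro _ ⟨d, hd, rfl⟩
    replace hd : (d.degree : ℤ) = s + 1 := hd
    obtain ⟨i, hi⟩ : ∃ i, d i ≠ 0 := by
      by_contra! h
      refine hs ?_
      rw [← hd, Finsupp.degree_eq_sum]
      simp [h]
    have hdi : Finsupp.single i 1 + (d - Finsupp.single i 1) = d :=
      add_tsub_cancel_of_le (Finsupp.single_le_iff.2 (Nat.one_le_iff_ne_zero.2 hi))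
    have hX : X i * monomial (d - Finsupp.single i 1) (1 : ℝ) = monomial d 1 := by
      rw [X, monomial_mul, one_mul, hdi]
    have hm : monomial (d - Finsupp.single i 1) (1 : ℝ) ∈ homog s := by
      refine mem_homog_of_eq (X_mul_mem_homog_iff (s := s + 1) (i := i).1 ?_) (by ring)
      rw [hX]
      exact (monomial_mem_restrictSupport ℝ).2 (Or.inl hd)
    refine ⟨_, ⟨Pi.single i ⟨_, hm⟩, rfl⟩, ?_⟩
    change (sumTriple (s + 1) (mulX s (Pi.single i ⟨_, hm⟩)) : MvPolynomial (Fin 3) ℝ) = _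
    rw [sumTriple_apply, Submodule.coe_sum, Finset.sum_eq_single i, coe_mulX, Pi.single_eq_same, hX]
    · intro j _ hj
      rw [coe_mulX, Pi.single_eq_of_ne hj, Submodule.coe_zero, mul_zero]
    · simp
  rintro ⟨p, hp⟩
  obtain ⟨_, ⟨q, rfl⟩, hq⟩ := hle hp
  exact ⟨q, Subtype.ext hq⟩

/-- The primitive of the differences is `f` minus the average of its entries, hence differs from `f`
by a diagonal triple. -/
theorem oneForm_cyclicPrimitive {s : ℤ} (f : Fin 3 → homog s) :
    oneForm (tripleCoe s (cyclicPrimitive s fun k => f (k + 1) - f (k + 2))) =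
      oneForm (tripleCoe s f) := by
  rw [← sub_eq_zero, ← map_sub, ← map_sub,
    oneForm_eq_zero_iff (r := s) fun i => by rw [tripleCoe_apply]; exact Subtype.prop _]
  intro k
  obtain ⟨h1, h2, h3, h4, -, -⟩ := fin_three_cyclic k
  rw [tripleCoe_apply, tripleCoe_apply]
  refine congrArg Subtype.val ?_
  simp only [Pi.sub_apply, cyclicPrimitive_apply, h1, h2, h3, h4]
  module

/-- A form is determined by the differences `f_{k+1} - f_{k+2}`. It is trace-free when these are
`λ_k q_k`, and triples `q` arise exactly when `∑ λ_k q_k = 0`. -/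
theorem finite_and_trace_PTraceFree {r : ℤ} (hr : r ≠ 0) :
    Module.Finite ℝ (PTraceFree r 1 2).toSubmodule ∧
    LinearMap.trace ℝ _ ((PTraceFree r 1 2).toRepresentation (finRotate 3)) =
      -LinearMap.trace ℝ _ (rot r) := by
  obtain ⟨s, rfl⟩ : ∃ s, r = s + 1 := ⟨r - 1, by ring⟩
  have hsub : ∀ q, (sumTriple (s + 1) ∘ₗ mulX s) q = 0 →
      ∀ k, cyclicPrimitive (s + 1) (mulX s q) (k + 1) -
        cyclicPrimitive (s + 1) (mulX s q) (k + 2) = mulX s q k := fun q hq =>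
    cyclicPrimitive_sub hq
  rw [← zero_sub, ← trace_rotTriple s]
  refine finite_and_trace_of_kernel (PTraceFree (s + 1) 1 2) (finRotate 3)
    (Φ := oneForm ∘ₗ tripleCoe (s + 1) ∘ₗ cyclicPrimitive (s + 1) ∘ₗ mulX s)
    (sumTriple_mulX_surjective hr) (fun ω => ?_) (fun q hq hq' => ?_) (fun q => ?_) (fun q => ?_)
  · constructor
    · rintro ⟨hω, hω'⟩
      obtain ⟨f, rfl⟩ := mem_P_iff.1 hω
      choose q hq hq' using fun k => exists_eq_X_mul_of_facet
        (sub_mem (f (k + 1)).2 (f (k + 2)).2) (k := k) fun x hx => by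
          rw [map_sub, sub_eq_zero]
          exact oneForm_mem_traceFree_iff.1 hω' k x hx
      rw [show s + 1 - 1 = s by ring] at hq
      have hD : mulX s (fun k => ⟨q k, hq k⟩) = fun k => f (k + 1) - f (k + 2) := by
        funext k
        exact Subtype.ext (hq' k).symm
      refine ⟨fun k => ⟨q k, hq k⟩, ?_, ?_⟩
      · rw [LinearMap.comp_apply, hD, sumTriple_apply, Fin.sum_univ_three]
        simp
      · simp only [LinearMap.comp_apply]
        rw [hD, oneForm_cyclicPrimitive]
        rfl
    · rintro ⟨q, hq, rfl⟩
      refine ⟨mem_P_iff.2 ⟨_, rfl⟩, oneForm_mem_traceFree_iff.2 fun k x hx => ?_⟩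
      simp only [LinearMap.comp_apply]
      rw [← sub_eq_zero, ← map_sub, tripleCoe_apply, tripleCoe_apply, ← Submodule.coe_sub,
        hsub q hq, coe_mulX, map_mul, eval_X, hx, zero_mul]
  · have h0 := (oneForm_eq_zero_iff (r := s + 1)
      (f := tripleCoe (s + 1) (cyclicPrimitive (s + 1) (mulX s q))) fun i => Subtype.prop _).1 hq'
    refine funext fun k => Subtype.ext ?_
    have h1 := congrArg Subtype.val (hsub q hq k)
    rw [Submodule.coe_sub, ← tripleCoe_apply, ← tripleCoe_apply, h0 k, sub_self] at h1
    exact (mul_eq_zero.1 h1.symm).resolve_left (X_ne_zero _)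
  · rw [LinearMap.comp_apply, LinearMap.comp_apply, mulX_rotTriple, sumTriple_rotTriple]
  · simp only [LinearMap.comp_apply]
    rw [pullbackRep_oneForm, mulX_rotTriple, cyclicPrimitive_rotTriple, tripleCoe_rotTriple]

/-- In degree zero the quotients `q_k` would have degree `-1`, so all differences vanish and the
space is zero. -/
theorem finite_and_trace_PTraceFree_zero : Module.Finite ℝ (PTraceFree 0 1 2).toSubmodule ∧
    LinearMap.trace ℝ _ ((PTraceFree 0 1 2).toRepresentation (finRotate 3)) = 0 := by
  have h : ∀ ω : (PTraceFree 0 1 2).toSubmodule, ω = 0 := fun ⟨ω, hω, hω'⟩ => by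
    obtain ⟨f, rfl⟩ := mem_P_iff.1 hω
    refine Subtype.ext ((oneForm_eq_zero_iff fun i => (f i).2).2 fun k => ?_)
    obtain ⟨q, hq, hq'⟩ := exists_eq_X_mul_of_facet
      (sub_mem (f (k + 1)).2 (f (k + 2)).2) (k := k) fun x hx => by
        rw [map_sub, sub_eq_zero]
        exact oneForm_mem_traceFree_iff.1 hω' k x hx
    have hq0 : q = 0 := by
      ext d
      by_contra hd
      have := mem_homog.1 hq d hd
      omega
    rw [← sub_eq_zero, hq', hq0, mul_zero]
  have : Subsingleton (PTraceFree 0 1 2).toSubmodule := ⟨fun a b => (h a).trans (h b).symm⟩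
  refine ⟨inferInstance, ?_⟩
  rw [Subsingleton.elim ((PTraceFree 0 1 2).toRepresentation (finRotate 3)) 0, map_zero]

end Resolutions

theorem sub_hasInvariantBasisUpToSign_iff {W : Subrepresentation (pullbackRep 1 2)} {s : ℤ}
    (h : Module.Finite ℝ W.toSubmodule ∧
      LinearMap.trace ℝ _ (W.toRepresentation (finRotate 3)) = -LinearMap.trace ℝ _ (rot s)) :
    SubHasInvariantBasisUpToSign W ↔ ¬ ∃ m : ℕ, s = 3 * (m : ℤ) := by
  have := h.1
  rw [← trace_rot_nonpos_iff, ← neg_nonneg, ← h.2]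
  exact hasInvariantBasisUpToSign_iff _

end FEEC

theorem theorem4p1 (r : ℤ) :
    (FEEC.SubHasInvariantBasisUpToSign (FEEC.P r 1 2) ↔
      ¬ ∃ m : ℕ, r = 3 * (m : ℤ)) ∧
    (FEEC.SubHasInvariantBasisUpToSign (FEEC.PMinus r 1 2) ↔
      ¬ ∃ m : ℕ, r = 3 * (m : ℤ) + 2) ∧
    (FEEC.SubHasInvariantBasisUpToSign (FEEC.PTraceFree r 1 2) ↔
      ¬ ∃ m : ℕ, r = 3 * (m : ℤ) + 3) ∧
    (FEEC.SubHasInvariantBasisUpToSign (FEEC.PMinusTraceFree r 1 2) ↔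
      ¬ ∃ m : ℕ, r = 3 * (m : ℤ) + 2) := by
  refine ⟨FEEC.sub_hasInvariantBasisUpToSign_iff (FEEC.finite_and_trace_P r), ?_, ?_, ?_⟩
  · rw [FEEC.sub_hasInvariantBasisUpToSign_iff (FEEC.finite_and_trace_PMinus r)]
    simp only [sub_eq_iff_eq_add]
  · by_cases hr : r = 0
    · subst hr
      have h := FEEC.finite_and_trace_PTraceFree_zero
      have := h.1
      refine iff_of_true ((FEEC.hasInvariantBasisUpToSign_iff _).2 h.2.ge) ?_
      rintro ⟨m, hm⟩
      omega
    · rw [FEEC.sub_hasInvariantBasisUpToSign_iff (FEEC.finite_and_trace_PTraceFree hr)]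
      refine not_congr ⟨?_, ?_⟩
      · rintro ⟨m, hm⟩
        -- Since `r ≠ 0`, `m` is positive and the subtraction does not truncate.
        exact ⟨m - 1, by omega⟩
      · rintro ⟨m, hm⟩
        exact ⟨m + 1, by omega⟩
  · rw [FEEC.sub_hasInvariantBasisUpToSign_iff (FEEC.finite_and_trace_PMinusTraceFree r)]
    simp only [sub_eq_iff_eq_add]
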